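/- Let $k\ge 0$ be an integer, let $b\in\mathcal C^{2k+2}(\mathbb R)$ and $v_0\in\mathcal C^{k+1}(\mathbb R)$ be real-valued and $1$-periodic, and for $x\in\mathbb R$ let $t\mapsto y_x(t)$, $t\in\mathbb R$, be the solution of $\dot y=b(y)$, $y(0)=x$. For $T>0$ let $v$ be the classical solution, $1$-periodic in $x$, of $v_t+b(x)v_x=0$ on $(0,T)\times\mathbb R$, $v(0,\cdot)=v_0$. For integers $N,M\ge 1$ put $\Delta t=T/N$, $t_n=n\Delta t$, $v^n=v(t_n,\cdot)$, $\Delta x=1/M$, $I_i=(i\Delta x,(i+1)\Delta x)$ for $0\le i<M$, and let $V_k$ be the space of functions on $(0,1)$, extended $1$-periodically, whose restriction to each $I_i$ is a polynomial of degree at most $k$. Let $\xi_0,\dots,\xi_k\in(-1,1)$ and $\omega_0,\dots,\omega_k>0$ be the Gauss points and weights, so that $\int_{-1}^1p(x)\,dx=\sum_\alpha\omega_\alpha p(\xi_\alpha)$ for all polynomials $p$ of degree at most $2k+1$. Scheme with computed characteristics: let $\bar y:[0,1]\to\mathbb R$, $x\mapsto\bar y_x(-\Delta t)$, be continuous and such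 that each $I_i$ contains only finitely many points $x_{i,1}<\dots<x_{i,p_i}$ at which $\bar y_x(-\Delta t)\in\Delta x\,\mathbb Z$. Put $x_{i,0}=i\Delta x$, $x_{i,p_i+1}=(i+1)\Delta x$, $\tilde w^i_{q,\alpha}=\frac{\omega_\alpha}{2}(x_{i,q+1}-x_{i,q})$ and $\tilde x^i_{q,\alpha}=x_{i,q}+\frac{1+\xi_\alpha}{2}(x_{i,q+1}-x_{i,q})$. Starting from some $u^0\in V_k$ (for instance the $L^2$-projection of $v_0$ on $V_k$), for $0\le n<N$ let $u^{n+1}\in V_k$ be defined by $$\int_0^1u^{n+1}\varphi\,dx=\sum_{i=0}^{M-1}\sum_{q=0}^{p_i}\sum_{\alpha=0}^k\tilde w^i_{q,\alpha}\,u^n\big(\bar y_{\tilde x^i_{q,\alpha}}(-\Delta t)\big)\,\varphi(\tilde x^i_{q,\alpha})\qquad\text{for all }\varphi\in V_k.$$ Then for every $K$ there are constants $C_1,C\ge 0$, depending only on $k$, $b$, $v_0$ and $K$, such that for all $T>0$, all $N,M\ge 1$, all $\varepsilon\le K\,\Delta x\,\Delta t$, all such $\bar y$ with $$|\bar y_x(-\Delta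 t)-y_x(-\Delta t)|\le\varepsilon\qquad\text{for all }x\in[0,1],$$ and all $u^0\in V_k$, $$\|u^n-v^n\|_{L^2(0,1)}\le e^{C_1T}\Big(\|v^0-u^0\|_{L^2(0,1)}+CT\,\frac{\Delta x^{k+1}}{\Delta t}+CT\,\frac{\varepsilon}{\Delta x\,\Delta t}\Big)\qquad\text{for all }0\le n\le N.$$ -/

import Mathlib

namespace SLDG

noncomputable section

/-- The characteristics: `y x` solves `y'(t) = b (y t)` for all real `t`, with `y x 0 = x`. -/
def IsCharacteristicFlow (b : ℝ → ℝ) (y : ℝ → ℝ → ℝ) : Prop :=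
  ∀ x, y x 0 = x ∧ ∀ t, HasDerivAt (y x) (b (y x t)) t

/-- `v t x` is the classical solution of `v_t + b v_x = 0` on `(0,T) × ℝ`, `1`-periodic in `x`,
with `v 0 = v₀`. -/
structure IsAdvectionSolution (b v₀ : ℝ → ℝ) (T : ℝ) (v : ℝ → ℝ → ℝ) : Prop where
  continuousOn : ContinuousOn (fun z : ℝ × ℝ => v z.1 z.2) (Set.Icc 0 T ×ˢ Set.univ)
  differentiableAt : ∀ t ∈ Set.Ioo 0 T, ∀ x,
    DifferentiableAt ℝ (fun z : ℝ × ℝ => v z.1 z.2) (t, x)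
  pde : ∀ t ∈ Set.Ioo 0 T, ∀ x, deriv (fun s => v s x) t + b x * deriv (v t) x = 0
  periodic : ∀ t ∈ Set.Icc 0 T, Function.Periodic (v t) 1
  initial : v 0 = v₀

/-- The Gauss quadrature rule with `k + 1` points `ξ α` and weights `ω α` on `(-1,1)`. -/
structure IsGaussRule (k : ℕ) (ξ ω : Fin (k + 1) → ℝ) : Prop where
  mem : ∀ α, ξ α ∈ Set.Ioo (-1 : ℝ) 1
  injective : Function.Injective ξ
  weight_pos : ∀ α, 0 < ω α
  exact : ∀ p : Polynomial ℝ, p.natDegree ≤ 2 * k + 1 →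
    ∫ x in (-1 : ℝ)..1, p.eval x = ∑ α, ω α * p.eval (ξ α)

/-- The open mesh cell `(i/M, (i+1)/M)`, of length `1/M`. -/
def cell (M i : ℕ) : Set ℝ := Set.Ioo ((i : ℝ) / M) (((i : ℝ) + 1) / M)

/-- The discontinuous Galerkin space on `(0,1)`: functions that are polynomials of degree at most
`k` on each of the `M` cells, extended `1`-periodically to `ℝ`. Values at mesh points (a null set
of `(0,1)`) are immaterial. -/
def IsDG (k M : ℕ) (u : ℝ → ℝ) : Prop :=
  Function.Periodic u 1 ∧
    ∀ i < M, ∃ p : Polynomial ℝ, p.natDegree ≤ k ∧ ∀ x ∈ cell M i, u x = p.eval x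

/-- The points of the `i`-th cell that `w` sends to some mesh point `ℓ/M`, `ℓ ∈ ℤ`. -/
def crossings (w : ℝ → ℝ) (M i : ℕ) : Set ℝ :=
  {x | x ∈ cell M i ∧ ∃ l : ℤ, w x = (l : ℝ) / M}

open Classical in
/-- The crossings as a finite set (only used when there are finitely many of them). -/
def crossingFinset (w : ℝ → ℝ) (M i : ℕ) : Finset ℝ :=
  if h : (crossings w M i).Finite then h.toFinset else ∅

/-- The breakpoints `x_{i,0} < x_{i,1} < ⋯ < x_{i,p} < x_{i,p+1}`: left end of the cell, the `p`
crossings in increasing order, right end of the cell. -/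
def breakpoint (w : ℝ → ℝ) (M i q : ℕ) : ℝ :=
  (((i : ℝ) / M) :: ((crossingFinset w M i).sort (· ≤ ·) ++ [((i : ℝ) + 1) / M])).getD q 0

/-- The quadrature node: image of `ξ ∈ (-1,1)` in the `q`-th subinterval of the `i`-th cell. -/
def node (w : ℝ → ℝ) (M i q : ℕ) (ξ : ℝ) : ℝ :=
  breakpoint w M i q + (1 + ξ) / 2 * (breakpoint w M i (q + 1) - breakpoint w M i q)

/-- The composite Gauss approximation of `∫₀¹ u(w x) φ(x) dx`, applying the Gauss rule on every
subinterval cut out by the crossings of `w`. -/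
def gaussForm {k : ℕ} (ξ ω : Fin (k + 1) → ℝ) (M : ℕ) (w u φ : ℝ → ℝ) : ℝ :=
  ∑ i ∈ Finset.range M, ∑ q ∈ Finset.range ((crossingFinset w M i).card + 1), ∑ α,
    ω α / 2 * (breakpoint w M i (q + 1) - breakpoint w M i q) *
      u (w (node w M i q (ξ α))) * φ (node w M i q (ξ α))

/-- One step `u ↦ u'` of the scheme in which `w` is used as the foot of the characteristics. -/
def IsSchemeStep {k : ℕ} (ξ ω : Fin (k + 1) → ℝ) (M : ℕ) (w u u' : ℝ → ℝ) : Prop :=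
  IsDG k M u' ∧
    ∀ φ, IsDG k M φ → ∫ x in (0 : ℝ)..1, u' x * φ x = gaussForm ξ ω M w u φ

/-- The `L²(0,1)` norm. -/
def l2norm (f : ℝ → ℝ) : ℝ := Real.sqrt (∫ x in (0 : ℝ)..1, f x ^ 2)

end

end SLDG

namespace SLDG

noncomputable section

/-! ### The flow of a scalar autonomous equation -/

/-- The slope `(b c - b a) / (c - a)` of `b`, written as an average of `b'`. -/
def avgDeriv (b : ℝ → ℝ) (a c : ℝ) : ℝ := ∫ θ in (0 : ℝ)..1, deriv b (a + θ * (c - a))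

lemma continuous_avgDeriv {b : ℝ → ℝ} (hb : ContDiff ℝ 1 b) :
    Continuous (fun z : ℝ × ℝ => avgDeriv b z.1 z.2) := by
  have h := hb.continuous_deriv le_rfl
  unfold avgDeriv
  exact intervalIntegral.continuous_parametric_intervalIntegral_of_continuous'
    (f := fun (z : ℝ × ℝ) θ => deriv b (z.1 + θ * (z.2 - z.1))) (by fun_prop) 0 1

lemma avgDeriv_mul_sub {b : ℝ → ℝ} (hb : ContDiff ℝ 1 b) (a c : ℝ) :
    avgDeriv b a c * (c - a) = b c - b a := by
  have h := hb.continuous_deriv le_rfl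
  have key := intervalIntegral.integral_eq_sub_of_hasDerivAt (a := 0) (b := 1)
    (f := fun θ => b (a + θ * (c - a))) (f' := fun θ => deriv b (a + θ * (c - a)) * (c - a))
    (fun θ _ => by
      have h1 : HasDerivAt (fun θ => a + θ * (c - a)) (c - a) θ := by
        simpa using ((hasDerivAt_id θ).mul_const (c - a)).const_add a
      exact ((hb.differentiable one_ne_zero _).hasDerivAt).comp θ h1)
    (Continuous.intervalIntegrable (by fun_prop) _ _)
  rw [intervalIntegral.integral_mul_const] at key
  simpa [avgDeriv] using key

lemma abs_avgDeriv_le {b : ℝ → ℝ} {L : ℝ} (hL : ∀ x, |deriv b x| ≤ L) (a c : ℝ) :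
    |avgDeriv b a c| ≤ L := by
  have := intervalIntegral.norm_integral_le_of_norm_le_const (a := 0) (b := 1)
    (f := fun θ => deriv b (a + θ * (c - a))) (C := L) (fun θ _ => hL _)
  simpa [avgDeriv] using this

lemma avgDeriv_self (b : ℝ → ℝ) (a : ℝ) : avgDeriv b a a = deriv b a := by
  simp [avgDeriv]

lemma solution_sub_eq {b f g : ℝ → ℝ} (hb : ContDiff ℝ 1 b)
    (hf : ∀ t, HasDerivAt f (b (f t)) t) (hg : ∀ t, HasDerivAt g (b (g t)) t) (t : ℝ) :
    g t - f t = (g 0 - f 0) * Real.exp (∫ s in (0 : ℝ)..t, avgDeriv b (f s) (g s)) := by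
  have cf : Continuous f := continuous_iff_continuousAt.2 fun t => (hf t).continuousAt
  have cg : Continuous g := continuous_iff_continuousAt.2 fun t => (hg t).continuousAt
  have cq : Continuous fun s => avgDeriv b (f s) (g s) :=
    (continuous_avgDeriv hb).comp (cf.prodMk cg)
  set q := fun s => avgDeriv b (f s) (g s) with hq
  have hI : ∀ t, HasDerivAt (fun t => ∫ s in (0 : ℝ)..t, q s) (q t) t := fun t =>
    intervalIntegral.integral_hasDerivAt_right (cq.intervalIntegrable _ _)
      cq.aestronglyMeasurable.stronglyMeasurableAtFilter cq.continuousAt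
  have hD : ∀ t, HasDerivAt (fun t => (g t - f t) * Real.exp (-∫ s in (0 : ℝ)..t, q s)) 0 t := by
    intro t
    refine (((hg t).fun_sub (hf t)).fun_mul (hI t).fun_neg.exp).congr_deriv ?_
    linear_combination -Real.exp (-∫ s in (0 : ℝ)..t, q s) * avgDeriv_mul_sub hb (f t) (g t)
  have hc := is_const_of_deriv_eq_zero (fun t => (hD t).differentiableAt) (fun t => (hD t).deriv) t 0
  simp only [intervalIntegral.integral_same, neg_zero, Real.exp_zero, mul_one] at hc
  rw [← hc, mul_assoc, ← Real.exp_add]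
  simp

lemma abs_integral_le_mul_abs {q : ℝ → ℝ} {L : ℝ} (hq : ∀ s, |q s| ≤ L) (t : ℝ) :
    |∫ s in (0 : ℝ)..t, q s| ≤ L * |t| := by
  simpa using intervalIntegral.norm_integral_le_of_norm_le_const (a := 0) (b := t) (f := q)
    (C := L) (fun s _ => hq s)

section flow

variable {b : ℝ → ℝ} {y : ℝ → ℝ → ℝ}

lemma IsCharacteristicFlow.sub_eq (hy : IsCharacteristicFlow b y) (hb : ContDiff ℝ 1 b)
    (x z t : ℝ) : y z t - y x t =
      (z - x) * Real.exp (∫ s in (0 : ℝ)..t, avgDeriv b (y x s) (y z s)) := by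
  have := solution_sub_eq hb (hy x).2 (hy z).2 t
  rwa [(hy x).1, (hy z).1] at this

lemma IsCharacteristicFlow.abs_sub_le (hy : IsCharacteristicFlow b y) (hb : ContDiff ℝ 1 b)
    {L : ℝ} (hL : ∀ x, |deriv b x| ≤ L) (x z t : ℝ) :
    |y z t - y x t| ≤ |z - x| * Real.exp (L * |t|) := by
  rw [hy.sub_eq hb, abs_mul, Real.abs_exp]
  gcongr
  exact (le_abs_self _).trans (abs_integral_le_mul_abs (fun s => abs_avgDeriv_le hL _ _) t)

lemma abs_exp_sub_one_le {r R : ℝ} (h : |r| ≤ R) : |Real.exp r - 1| ≤ Real.exp R - 1 := by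
  have h1 : Real.exp r ≤ Real.exp R := Real.exp_le_exp.2 ((le_abs_self _).trans h)
  have h2 : Real.exp (-R) ≤ Real.exp r := Real.exp_le_exp.2 (neg_le_of_abs_le h)
  have h3 : Real.exp R * Real.exp (-R) = 1 := by rw [← Real.exp_add]; simp
  have h4 := Real.exp_pos R
  have h5 := Real.exp_pos (-R)
  rw [abs_le]
  constructor <;> nlinarith [sq_nonneg (Real.exp R - 1), sq_nonneg (Real.exp (-R) - 1)]

lemma IsCharacteristicFlow.abs_displacement_sub_le (hy : IsCharacteristicFlow b y)
    (hb : ContDiff ℝ 1 b) {L : ℝ} (hL : ∀ x, |deriv b x| ≤ L) (x z t : ℝ) :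
    |(y z t - z) - (y x t - x)| ≤ (Real.exp (L * |t|) - 1) * |z - x| := by
  have : (y z t - z) - (y x t - x) =
      (Real.exp (∫ s in (0 : ℝ)..t, avgDeriv b (y x s) (y z s)) - 1) * (z - x) := by
    linear_combination hy.sub_eq hb x z t
  rw [this, abs_mul]
  gcongr
  exact abs_exp_sub_one_le (abs_integral_le_mul_abs (fun s => abs_avgDeriv_le hL _ _) t)

lemma IsCharacteristicFlow.strictMono (hy : IsCharacteristicFlow b y) (hb : ContDiff ℝ 1 b)
    (t : ℝ) : StrictMono fun x => y x t := fun x z h => by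
  have := hy.sub_eq hb x z t
  have h2 : 0 < (z - x) * Real.exp (∫ s in (0 : ℝ)..t, avgDeriv b (y x s) (y z s)) :=
    mul_pos (sub_pos.2 h) (Real.exp_pos _)
  show y x t < y z t
  linarith

lemma solution_unique {f g : ℝ → ℝ} (hb : ContDiff ℝ 1 b)
    (hf : ∀ t, HasDerivAt f (b (f t)) t) (hg : ∀ t, HasDerivAt g (b (g t)) t) (h0 : f 0 = g 0)
    (t : ℝ) : f t = g t := by
  have := solution_sub_eq hb hf hg t
  rw [h0, sub_self, zero_mul] at this
  linarith

lemma IsCharacteristicFlow.flow_add (hy : IsCharacteristicFlow b y) (hb : ContDiff ℝ 1 b)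
    (x s t : ℝ) : y (y x s) t = y x (s + t) := by
  refine solution_unique hb (hy _).2 (g := fun t => y x (s + t)) (fun t => ?_) ?_ t
  · simpa using ((hy x).2 (s + t)).comp_const_add s t
  · simp [(hy _).1]

lemma IsCharacteristicFlow.flow_neg_flow (hy : IsCharacteristicFlow b y) (hb : ContDiff ℝ 1 b)
    (x t : ℝ) : y (y x t) (-t) = x := by
  rw [hy.flow_add hb]; simp [(hy x).1]

lemma IsCharacteristicFlow.flow_flow_neg (hy : IsCharacteristicFlow b y) (hb : ContDiff ℝ 1 b)
    (x t : ℝ) : y (y x (-t)) t = x := by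
  rw [hy.flow_add hb]; simp [(hy x).1]

lemma IsCharacteristicFlow.add_int (hy : IsCharacteristicFlow b y) (hb : ContDiff ℝ 1 b)
    (hper : Function.Periodic b 1) (x t : ℝ) (m : ℤ) : y (x + m) t = y x t + m := by
  refine solution_unique hb (hy _).2 (g := fun t => y x t + m) (fun t => ?_) ?_ t
  · have hp : b (y x t + m) = b (y x t) := by simpa using hper.int_mul m (y x t)
    rw [hp]
    exact ((hy x).2 t).add_const _
  · simp [(hy _).1]

lemma IsCharacteristicFlow.continuous_uncurry (hy : IsCharacteristicFlow b y)
    (hb : ContDiff ℝ 1 b) {L : ℝ} (hL : ∀ x, |deriv b x| ≤ L) :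
    Continuous fun z : ℝ × ℝ => y z.2 z.1 := by
  rw [continuous_iff_continuousAt]
  rintro ⟨t, x⟩
  have h1 : Filter.Tendsto (fun z : ℝ × ℝ => |z.2 - x| * Real.exp (L * |z.1|))
      (nhds (t, x)) (nhds 0) := by
    have : Continuous fun z : ℝ × ℝ => |z.2 - x| * Real.exp (L * |z.1|) := by fun_prop
    simpa using this.tendsto (t, x)
  have h2 : Filter.Tendsto (fun z : ℝ × ℝ => y x z.1) (nhds (t, x)) (nhds (y x t)) :=
    ((hy x).2 t).continuousAt.tendsto.comp (continuous_fst.tendsto (t, x))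
  have h3 : Filter.Tendsto (fun z : ℝ × ℝ => y z.2 z.1 - y x z.1) (nhds (t, x)) (nhds 0) :=
    squeeze_zero_norm (fun z => hy.abs_sub_le hb hL x z.2 z.1) h1
  simpa [ContinuousAt] using h3.add h2

/-- The spatial derivative of the flow. -/
def flowDeriv (b : ℝ → ℝ) (y : ℝ → ℝ → ℝ) (t x : ℝ) : ℝ :=
  Real.exp (∫ s in (0 : ℝ)..t, deriv b (y x s))

lemma IsCharacteristicFlow.hasDerivAt_space (hy : IsCharacteristicFlow b y)
    (hb : ContDiff ℝ 1 b) {L : ℝ} (hL : ∀ x, |deriv b x| ≤ L) (t x : ℝ) :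
    HasDerivAt (fun x => y x t) (flowDeriv b y t x) x := by
  have hc := hy.continuous_uncurry hb hL
  have h1 : Continuous fun z => Real.exp (∫ s in (0 : ℝ)..t, avgDeriv b (y x s) (y z s)) := by
    refine Real.continuous_exp.comp
      (intervalIntegral.continuous_parametric_intervalIntegral_of_continuous'
        (f := fun z s => avgDeriv b (y x s) (y z s)) ?_ 0 t)
    refine (continuous_avgDeriv hb).comp (Continuous.prodMk ?_ ?_)
    · exact hc.comp (continuous_snd.prodMk continuous_const)
    · exact hc.comp (continuous_snd.prodMk continuous_fst)
  have h2 := h1.tendsto x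
  simp only [avgDeriv_self] at h2
  rw [hasDerivAt_iff_tendsto_slope]
  refine (h2.mono_left nhdsWithin_le_nhds).congr' ?_
  filter_upwards [self_mem_nhdsWithin] with z hz
  have hz' : z - x ≠ 0 := sub_ne_zero.2 hz
  rw [slope_def_field, hy.sub_eq hb, mul_div_cancel_left₀ _ hz']

lemma flowDeriv_pos (t x : ℝ) : 0 < flowDeriv b y t x := Real.exp_pos _

lemma flowDeriv_le {L : ℝ} (hL : ∀ x, |deriv b x| ≤ L) (t x : ℝ) :
    flowDeriv b y t x ≤ Real.exp (L * |t|) :=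
  Real.exp_le_exp.2 ((le_abs_self _).trans (abs_integral_le_mul_abs (fun _ => hL _) t))

lemma IsCharacteristicFlow.continuous_flowDeriv (hy : IsCharacteristicFlow b y)
    (hb : ContDiff ℝ 1 b) {L : ℝ} (hL : ∀ x, |deriv b x| ≤ L) (t : ℝ) :
    Continuous (flowDeriv b y t) := by
  have hc := hy.continuous_uncurry hb hL
  refine Real.continuous_exp.comp
    (intervalIntegral.continuous_parametric_intervalIntegral_of_continuous'
      (f := fun z s => deriv b (y z s)) ?_ 0 t)
  exact (hb.continuous_deriv le_rfl).comp (hc.comp (continuous_snd.prodMk continuous_fst))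

/-- Change of variables along the flow. -/
lemma IsCharacteristicFlow.integral_comp_le (hy : IsCharacteristicFlow b y)
    (hb : ContDiff ℝ 1 b) {L : ℝ} (hL : ∀ x, |deriv b x| ≤ L) {g : ℝ → ℝ} (hg : Continuous g)
    (hg0 : ∀ x, 0 ≤ g x) {α β : ℝ} (hαβ : α ≤ β) (t : ℝ) :
    ∫ x in (y α t)..(y β t), g (y x (-t)) ≤ Real.exp (L * |t|) * ∫ z in α..β, g z := by
  have hc : Continuous fun x => y x (-t) :=
    (hy.continuous_uncurry hb hL).comp (continuous_const.prodMk continuous_id)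
  have hd := hy.continuous_flowDeriv hb hL t
  rw [← intervalIntegral.integral_comp_mul_deriv
    (g := fun x => g (y x (-t))) (fun x _ => hy.hasDerivAt_space hb hL t x) hd.continuousOn
    (hg.comp hc), ← intervalIntegral.integral_const_mul]
  refine intervalIntegral.integral_mono_on hαβ (Continuous.intervalIntegrable ?_ _ _)
    (Continuous.intervalIntegrable (by fun_prop) _ _) fun x _ => ?_
  · simp only [Function.comp_def, hy.flow_neg_flow hb]; fun_prop
  · simp only [Function.comp_def, hy.flow_neg_flow hb]
    rw [mul_comm]
    exact mul_le_mul_of_nonneg_right (flowDeriv_le hL t x) (hg0 x)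

end flow

/-! ### Spatial regularity with exponential growth in time -/

/-- `f t x` is jointly continuous and grows at most exponentially in time. -/
def ExpBounded (f : ℝ → ℝ → ℝ) : Prop :=
  Continuous (fun z : ℝ × ℝ => f z.1 z.2) ∧ ∃ C, 0 ≤ C ∧ ∀ t x, |f t x| ≤ C * Real.exp (C * |t|)

/-- `f t x` has `m` derivatives in `x`, all of them jointly continuous and of at most exponential
growth in time. -/
def SmoothGrowth : ℕ → (ℝ → ℝ → ℝ) → Prop
  | 0, f => ExpBounded f
  | m + 1, f => ExpBounded f ∧
      ∃ f', (∀ t x, HasDerivAt (f t) (f' t x) x) ∧ SmoothGrowth m f'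

lemma SmoothGrowth.expBounded {m : ℕ} {f : ℝ → ℝ → ℝ} (h : SmoothGrowth m f) : ExpBounded f := by
  cases m with
  | zero => exact h
  | succ m => exact h.1

lemma SmoothGrowth.of_succ {m : ℕ} {f : ℝ → ℝ → ℝ} (h : SmoothGrowth (m + 1) f) :
    SmoothGrowth m f := by
  induction m generalizing f with
  | zero => exact h.1
  | succ m ih =>
    obtain ⟨h0, f', hd, h'⟩ := h
    exact ⟨h0, f', hd, ih h'⟩

lemma ExpBounded.add {f g : ℝ → ℝ → ℝ} (hf : ExpBounded f) (hg : ExpBounded g) :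
    ExpBounded fun t x => f t x + g t x := by
  obtain ⟨cf, C, hC, bf⟩ := hf
  obtain ⟨cg, D, hD, bg⟩ := hg
  refine ⟨cf.add cg, C + D, by positivity, fun t x => ?_⟩
  have e1 : Real.exp (C * |t|) ≤ Real.exp ((C + D) * |t|) :=
    Real.exp_le_exp.2 (by nlinarith [abs_nonneg t])
  have e2 : Real.exp (D * |t|) ≤ Real.exp ((C + D) * |t|) :=
    Real.exp_le_exp.2 (by nlinarith [abs_nonneg t])
  calc |f t x + g t x| ≤ |f t x| + |g t x| := abs_add_le _ _
    _ ≤ C * Real.exp (C * |t|) + D * Real.exp (D * |t|) := add_le_add (bf t x) (bg t x)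
    _ ≤ C * Real.exp ((C + D) * |t|) + D * Real.exp ((C + D) * |t|) := by gcongr
    _ = _ := by ring

lemma ExpBounded.mul {f g : ℝ → ℝ → ℝ} (hf : ExpBounded f) (hg : ExpBounded g) :
    ExpBounded fun t x => f t x * g t x := by
  obtain ⟨cf, C, hC, bf⟩ := hf
  obtain ⟨cg, D, hD, bg⟩ := hg
  refine ⟨cf.mul cg, C * D + C + D, by positivity, fun t x => ?_⟩
  have ht := abs_nonneg t
  calc |f t x * g t x| = |f t x| * |g t x| := abs_mul _ _
    _ ≤ (C * Real.exp (C * |t|)) * (D * Real.exp (D * |t|)) := by gcongr; exacts [bf t x, bg t x]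
    _ = C * D * Real.exp ((C + D) * |t|) := by rw [add_mul, Real.exp_add]; ring
    _ ≤ (C * D + C + D) * Real.exp ((C * D + C + D) * |t|) := by
      have : 0 ≤ C * D := mul_nonneg hC hD
      gcongr <;> linarith

lemma SmoothGrowth.add {m : ℕ} {f g : ℝ → ℝ → ℝ} (hf : SmoothGrowth m f) (hg : SmoothGrowth m g) :
    SmoothGrowth m fun t x => f t x + g t x := by
  induction m generalizing f g with
  | zero => exact ExpBounded.add hf hg
  | succ m ih =>
    obtain ⟨hf0, f', df, hf'⟩ := hf
    obtain ⟨hg0, g', dg, hg'⟩ := hg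
    exact ⟨hf0.add hg0, _, fun t x => (df t x).add (dg t x), ih hf' hg'⟩

lemma SmoothGrowth.mul {m : ℕ} {f g : ℝ → ℝ → ℝ} (hf : SmoothGrowth m f) (hg : SmoothGrowth m g) :
    SmoothGrowth m fun t x => f t x * g t x := by
  induction m generalizing f g with
  | zero => exact ExpBounded.mul hf hg
  | succ m ih =>
    have hf1 := hf.of_succ
    have hg1 := hg.of_succ
    obtain ⟨hf0, f', df, hf'⟩ := hf
    obtain ⟨hg0, g', dg, hg'⟩ := hg
    exact ⟨hf0.mul hg0, _, fun t x => (df t x).mul (dg t x), (ih hf' hg1).add (ih hf1 hg')⟩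

lemma ExpBounded.integral {f : ℝ → ℝ → ℝ} (hf : ExpBounded f) :
    ExpBounded fun t x => ∫ s in (0 : ℝ)..t, f s x := by
  obtain ⟨cf, C, hC, bf⟩ := hf
  refine ⟨?_, C + 1, by positivity, fun t x => ?_⟩
  · exact intervalIntegral.continuous_parametric_intervalIntegral_of_continuous
      (f := fun (z : ℝ × ℝ) s => f s z.2)
      (cf.comp (continuous_snd.prodMk (continuous_snd.comp continuous_fst))) continuous_fst
  · have h1 : |∫ s in (0 : ℝ)..t, f s x| ≤ (C * Real.exp (C * |t|)) * |t - 0| := by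
      refine intervalIntegral.norm_integral_le_of_norm_le_const (f := fun s => f s x)
        fun s hs => ?_
      have hs' : |s| ≤ |t| := by
        rcases Set.mem_uIoc.1 hs with h | h
        · rw [abs_of_pos h.1, abs_of_pos (h.1.trans_le h.2)]; exact h.2
        · rw [abs_of_nonpos h.2, abs_of_neg (h.1.trans_le h.2)]; linarith [h.1]
      refine (bf s x).trans ?_
      gcongr
    have h2 : |t| ≤ Real.exp |t| := (by linarith : |t| ≤ |t| + 1).trans (Real.add_one_le_exp _)
    rw [sub_zero] at h1
    calc _ ≤ C * Real.exp (C * |t|) * |t| := h1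
      _ ≤ C * Real.exp (C * |t|) * Real.exp |t| := by gcongr
      _ = C * Real.exp ((C + 1) * |t|) := by rw [add_mul, one_mul, Real.exp_add]; ring
      _ ≤ _ := by gcongr; linarith

lemma SmoothGrowth.integral {m : ℕ} {f : ℝ → ℝ → ℝ} (hf : SmoothGrowth m f) :
    SmoothGrowth m fun t x => ∫ s in (0 : ℝ)..t, f s x := by
  induction m generalizing f with
  | zero => exact ExpBounded.integral hf
  | succ m ih =>
    obtain ⟨hf0, f', df, hf'⟩ := hf
    refine ⟨hf0.integral, _, fun t x => ?_, ih hf'⟩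
    obtain ⟨cf, -⟩ := hf0
    obtain ⟨cf', C, hC, bf'⟩ := hf'.expBounded
    have c1 : ∀ x, Continuous fun s => f s x := fun x =>
      cf.comp (continuous_id.prodMk continuous_const)
    have c2 : Continuous fun s => f' s x := cf'.comp (continuous_id.prodMk continuous_const)
    exact (intervalIntegral.hasDerivAt_integral_of_dominated_loc_of_deriv_le
      (F := fun x s => f s x) (F' := fun x s => f' s x) (s := Set.univ)
      (bound := fun s => C * Real.exp (C * |s|)) Filter.univ_mem
      (Filter.Eventually.of_forall fun x => (c1 x).aestronglyMeasurable)
      ((c1 x).intervalIntegrable _ _) c2.aestronglyMeasurable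
      (Filter.Eventually.of_forall fun s _ z _ => bf' s z)
      (Continuous.intervalIntegrable (by fun_prop) _ _)
      (Filter.Eventually.of_forall fun s _ z _ => df s z)).2

lemma SmoothGrowth.exp {m : ℕ} {f : ℝ → ℝ → ℝ} (hf : SmoothGrowth m f)
    (h0 : ExpBounded fun t x => Real.exp (f t x)) :
    SmoothGrowth m fun t x => Real.exp (f t x) := by
  induction m with
  | zero => exact h0
  | succ m ih =>
    have hf1 := hf.of_succ
    obtain ⟨-, f', df, hf'⟩ := hf
    exact ⟨h0, _, fun t x => (df t x).exp, (ih hf1).mul hf'⟩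

/-! ### Periodic functions of class `C^m` -/

lemma _root_.Function.Periodic.deriv_periodic {h : ℝ → ℝ} {c : ℝ} (hp : Function.Periodic h c) :
    Function.Periodic (deriv h) c := fun x => by
  rw [← deriv_comp_add_const]
  congr 1
  exact funext hp

lemma _root_.Function.Periodic.exists_abs_le {h : ℝ → ℝ} (hp : Function.Periodic h 1)
    (hc : Continuous h) : ∃ C, 0 ≤ C ∧ ∀ x, |h x| ≤ C := by
  obtain ⟨C, hC⟩ := (hp.isBounded_of_continuous one_ne_zero hc).exists_norm_le
  exact ⟨C, (norm_nonneg _).trans (hC _ ⟨0, rfl⟩), fun x => hC _ ⟨x, rfl⟩⟩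

lemma expBounded_of_bounded {h : ℝ → ℝ} {Y : ℝ → ℝ → ℝ} {C : ℝ} (hC : 0 ≤ C)
    (hb : ∀ x, |h x| ≤ C) (hc : Continuous h) (hY : Continuous fun z : ℝ × ℝ => Y z.1 z.2) :
    ExpBounded fun t x => h (Y t x) := by
  refine ⟨hc.comp hY, C, hC, fun t x => (hb _).trans ?_⟩
  exact le_mul_of_one_le_right hC (Real.one_le_exp (by positivity))

lemma smoothGrowth_comp {m : ℕ} {h : ℝ → ℝ} {Y Y' : ℝ → ℝ → ℝ} (hh : ContDiff ℝ m h)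
    (hp : Function.Periodic h 1) (hY : Continuous fun z : ℝ × ℝ => Y z.1 z.2)
    (hd : ∀ t x, HasDerivAt (Y t) (Y' t x) x) (hY' : SmoothGrowth (m - 1) Y') :
    SmoothGrowth m fun t x => h (Y t x) := by
  induction m generalizing h with
  | zero =>
    obtain ⟨C, hC, hb⟩ := hp.exists_abs_le hh.continuous
    exact expBounded_of_bounded hC hb hh.continuous hY
  | succ m ih =>
    obtain ⟨C, hC, hb⟩ := hp.exists_abs_le hh.continuous
    have hh1 : ContDiff ℝ m (deriv h) := by
      have : ContDiff ℝ ((m : WithTop ℕ∞) + 1) h := by exact_mod_cast hh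
      exact (contDiff_succ_iff_deriv.1 this).2.2
    have hdiff : Differentiable ℝ h := hh.differentiable (by simp)
    have hY1 : SmoothGrowth m Y' := by simpa using hY'
    refine ⟨expBounded_of_bounded hC hb hh.continuous hY, _,
      fun t x => ((hdiff (Y t x)).hasDerivAt).comp x (hd t x), SmoothGrowth.mul ?_ hY1⟩
    refine ih hh1 hp.deriv_periodic ?_
    cases m with
    | zero => exact hY1
    | succ m => exact hY1.of_succ

section flow

variable {b : ℝ → ℝ} {y : ℝ → ℝ → ℝ}

lemma IsCharacteristicFlow.smoothGrowth_flowDeriv (hy : IsCharacteristicFlow b y) {m : ℕ}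
    (hb : ContDiff ℝ (m + 1 : ℕ) b) (hp : Function.Periodic b 1) :
    SmoothGrowth m (flowDeriv b y) := by
  have hb1 : ContDiff ℝ 1 b := hb.of_le (by exact_mod_cast (by omega : 1 ≤ m + 1))
  have hdc := hb1.continuous_deriv le_rfl
  obtain ⟨L, hL0, hL⟩ := hp.deriv_periodic.exists_abs_le hdc
  have hc := hy.continuous_uncurry hb1 hL
  have h0 : ExpBounded (flowDeriv b y) := by
    refine ⟨?_, L + 1, by positivity, fun t x => ?_⟩
    · refine Real.continuous_exp.comp
        (ExpBounded.integral (f := fun s x => deriv b (y x s)) ?_).1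
      exact expBounded_of_bounded hL0 hL hdc (Y := fun t x => y x t) hc
    · rw [abs_of_pos (flowDeriv_pos t x)]
      refine (flowDeriv_le hL t x).trans ?_
      calc Real.exp (L * |t|) ≤ Real.exp ((L + 1) * |t|) := by gcongr; linarith
        _ ≤ _ := le_mul_of_one_le_left (Real.exp_pos _).le (by linarith)
  have key : ∀ j ≤ m, SmoothGrowth j (flowDeriv b y) := by
    intro j hj
    induction j with
    | zero => exact h0
    | succ j ih =>
      refine SmoothGrowth.exp (f := fun t x => ∫ s in (0 : ℝ)..t, deriv b (y x s)) ?_ h0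
      refine SmoothGrowth.integral (f := fun s x => deriv b (y x s)) ?_
      refine smoothGrowth_comp (Y := fun t x => y x t) ?_ hp.deriv_periodic hc
        (hy.hasDerivAt_space hb1 hL) (ih (by omega))
      have : ContDiff ℝ ((m : WithTop ℕ∞) + 1) b := by exact_mod_cast hb
      exact (contDiff_succ_iff_deriv.1 this).2.2.of_le (by exact_mod_cast hj)
  exact key m le_rfl

lemma IsCharacteristicFlow.smoothGrowth_comp_flow (hy : IsCharacteristicFlow b y) {m : ℕ}
    (hb : ContDiff ℝ (m + 1 : ℕ) b) (hp : Function.Periodic b 1) {h : ℝ → ℝ}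
    (hh : ContDiff ℝ (m + 1 : ℕ) h) (hhp : Function.Periodic h 1) :
    SmoothGrowth (m + 1) fun t x => h (y x t) := by
  have hb1 : ContDiff ℝ 1 b := hb.of_le (by exact_mod_cast (by omega : 1 ≤ m + 1))
  obtain ⟨L, hL0, hL⟩ := hp.deriv_periodic.exists_abs_le (hb1.continuous_deriv le_rfl)
  exact smoothGrowth_comp (Y := fun t x => y x t) hh hhp (hy.continuous_uncurry hb1 hL)
    (hy.hasDerivAt_space hb1 hL) (hy.smoothGrowth_flowDeriv hb hp)

end flow

/-! ### Local polynomial approximation -/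

lemma exists_polynomial_derivative_eq {n : ℕ} (p : Polynomial ℝ) (hp : p.natDegree ≤ n) :
    ∃ q : Polynomial ℝ, q.natDegree ≤ n + 1 ∧ q.derivative = p := by
  refine ⟨∑ i ∈ Finset.range (n + 1), Polynomial.monomial (i + 1) (p.coeff i / (i + 1)), ?_, ?_⟩
  · refine Polynomial.natDegree_sum_le_of_forall_le _ _ fun i hi => ?_
    have := Finset.mem_range.1 hi
    exact (Polynomial.natDegree_monomial_le _).trans (by omega)
  · rw [Polynomial.derivative_sum]
    conv_rhs => rw [p.as_sum_range' (n + 1) (by omega)]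
    refine Finset.sum_congr rfl fun i _ => ?_
    rw [Polynomial.derivative_monomial]
    congr 1
    push_cast
    field_simp

lemma SmoothGrowth.exists_polynomial {m : ℕ} {f : ℝ → ℝ → ℝ} (hf : SmoothGrowth (m + 1) f) :
    ∃ C, 0 ≤ C ∧ ∀ t a h, 0 ≤ h → ∃ p : Polynomial ℝ, p.natDegree ≤ m ∧
      ∀ x ∈ Set.Icc a (a + h), |f t x - p.eval x| ≤ C * Real.exp (C * |t|) * h ^ (m + 1) := by
  have mvt : ∀ (g g' : ℝ → ℝ) (a h B : ℝ), (∀ x, HasDerivAt g (g' x) x) → g a = 0 →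
      (∀ x ∈ Set.Icc a (a + h), |g' x| ≤ B) → ∀ x ∈ Set.Icc a (a + h), |g x| ≤ B * h := by
    intro g g' a h B hd ha hB x hx
    have hB0 : 0 ≤ B := (abs_nonneg _).trans (hB x hx)
    have := (convex_Icc a (a + h)).norm_image_sub_le_of_norm_hasDerivWithin_le
      (fun x hx => (hd x).hasDerivWithinAt) hB ⟨le_rfl, hx.1.trans hx.2⟩ hx
    rw [ha, sub_zero, Real.norm_eq_abs, Real.norm_eq_abs, abs_of_nonneg (sub_nonneg.2 hx.1)] at this
    exact this.trans (mul_le_mul_of_nonneg_left (by linarith [hx.2]) hB0)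
  induction m generalizing f with
  | zero =>
    obtain ⟨-, f', df, -, C, hC, hb⟩ := hf
    refine ⟨C, hC, fun t a h hh => ⟨Polynomial.C (f t a), by simp, fun x hx => ?_⟩⟩
    have := mvt (fun x => f t x - f t a) (f' t) a h _ (fun x => (df t x).sub_const _) (sub_self _)
      (fun x _ => hb t x) x hx
    simpa using this
  | succ m ih =>
    obtain ⟨-, f', df, hf'⟩ := hf
    obtain ⟨C, hC, H⟩ := ih hf'
    refine ⟨C, hC, fun t a h hh => ?_⟩
    obtain ⟨p, hp, hpx⟩ := H t a h hh
    obtain ⟨q, hq, hqp⟩ := exists_polynomial_derivative_eq p hp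
    refine ⟨q + Polynomial.C (f t a - q.eval a), ?_, fun x hx => ?_⟩
    · exact (Polynomial.natDegree_add_C).trans_le hq
    · have := mvt (fun x => f t x - (q + Polynomial.C (f t a - q.eval a)).eval x)
        (fun x => f' t x - p.eval x) a h _
        (fun x => by
          have h2 := (q + Polynomial.C (f t a - q.eval a)).hasDerivAt x
          simp only [Polynomial.derivative_add, Polynomial.derivative_C, add_zero, hqp] at h2
          exact (df t x).sub h2)
        (by simp) hpx x hx
      rw [pow_succ, ← mul_assoc]
      exact this

/-! ### Gauss rules and inverse inequalities for polynomials -/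

lemma exists_abs_eval_le {n : ℕ} (q : Polynomial ℝ) (hq : q.natDegree ≤ n) :
    ∃ A, 0 ≤ A ∧ ∀ R s, 1 ≤ R → |s| ≤ R → |q.eval s| ≤ A * R ^ n := by
  refine ⟨∑ i ∈ Finset.range (n + 1), |q.coeff i|, by positivity, fun R s hR hs => ?_⟩
  rw [Polynomial.eval_eq_sum_range' (Nat.lt_succ_of_le hq), Finset.sum_mul]
  refine (Finset.abs_sum_le_sum_abs _ _).trans (Finset.sum_le_sum fun i hi => ?_)
  rw [abs_mul, abs_pow]
  gcongr
  calc |s| ^ i ≤ R ^ i := by gcongr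
    _ ≤ R ^ n := pow_le_pow_right₀ hR (Nat.lt_succ_iff.1 (Finset.mem_range.1 hi))

lemma exists_abs_eval_sub_le {n : ℕ} (q : Polynomial ℝ) (hq : q.natDegree ≤ n) :
    ∃ A, 0 ≤ A ∧ ∀ R s s', 1 ≤ R → |s| ≤ R → |s'| ≤ R →
      |q.eval s - q.eval s'| ≤ A * R ^ n * |s - s'| := by
  obtain ⟨A, hA, h⟩ := exists_abs_eval_le q.derivative
    ((Polynomial.natDegree_derivative_le q).trans ((Nat.sub_le _ _).trans hq))
  refine ⟨A, hA, fun R s s' hR hs hs' => ?_⟩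
  have := (convex_Icc (-R) R).norm_image_sub_le_of_norm_hasDerivWithin_le
    (f := fun x => q.eval x) (fun x _ => (q.hasDerivAt x).hasDerivWithinAt)
    (fun x hx => h R x hR (abs_le.2 hx)) (abs_le.1 hs') (abs_le.1 hs)
  simpa [Real.norm_eq_abs] using this

section gauss

variable {k : ℕ} {ξ ω : Fin (k + 1) → ℝ}

lemma IsGaussRule.sum_weight (hG : IsGaussRule k ξ ω) : ∑ α, ω α = 2 := by
  have := hG.exact 1 (by simp)
  simp only [Polynomial.eval_one, mul_one, intervalIntegral.integral_const, smul_eq_mul] at this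
  linarith

lemma IsGaussRule.integral_eq (hG : IsGaussRule k ξ ω) {p : Polynomial ℝ}
    (hp : p.natDegree ≤ 2 * k + 1) (l r : ℝ) :
    ∑ α, ω α / 2 * (r - l) * p.eval (l + (1 + ξ α) / 2 * (r - l)) = ∫ x in l..r, p.eval x := by
  have h := hG.exact (p.comp (Polynomial.C ((r - l) / 2) * Polynomial.X +
    Polynomial.C ((l + r) / 2))) (by
      refine Polynomial.natDegree_comp_le.trans ?_
      refine (Nat.mul_le_mul_left _ (Polynomial.natDegree_linear_le)).trans (by omega))
  have h2 := intervalIntegral.smul_integral_comp_mul_add (a := -1) (b := 1)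
    (fun x => p.eval x) ((r - l) / 2) ((l + r) / 2)
  simp only [Polynomial.eval_comp, Polynomial.eval_add, Polynomial.eval_mul, Polynomial.eval_C,
    Polynomial.eval_X] at h
  rw [h, smul_eq_mul, Finset.mul_sum] at h2
  rw [show (r - l) / 2 * (-1) + (l + r) / 2 = l by ring,
    show (r - l) / 2 * 1 + (l + r) / 2 = r by ring] at h2
  rw [← h2]
  refine Finset.sum_congr rfl fun α _ => ?_
  rw [show l + (1 + ξ α) / 2 * (r - l) = (r - l) / 2 * ξ α + (l + r) / 2 by ring]
  ring

lemma IsGaussRule.exists_eval_bound (hG : IsGaussRule k ξ ω) :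
    ∃ B, 0 ≤ B ∧ ∀ p : Polynomial ℝ, p.natDegree ≤ k → ∀ R s s', 1 ≤ R → |s| ≤ R → |s'| ≤ R →
      |p.eval s| ≤ B * R ^ k * √(∫ x in (-1 : ℝ)..1, p.eval x ^ 2) ∧
      |p.eval s - p.eval s'| ≤ B * R ^ k * |s - s'| * √(∫ x in (-1 : ℝ)..1, p.eval x ^ 2) := by
  have hdeg : ∀ α, (Lagrange.basis Finset.univ ξ α).natDegree ≤ k := fun α => by
    rw [Lagrange.natDegree_basis hG.injective.injOn (Finset.mem_univ α)]; simp
  choose A₁ hA₁ h₁ using fun α => exists_abs_eval_le _ (hdeg α)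
  choose A₂ hA₂ h₂ using fun α => exists_abs_eval_sub_le _ (hdeg α)
  refine ⟨∑ α, (1 / √(ω α)) * (A₁ α + A₂ α), Finset.sum_nonneg fun α _ => by
    have := hA₁ α; have := hA₂ α; positivity, fun p hp R s s' hR hs hs' => ?_⟩
  set I := ∫ x in (-1 : ℝ)..1, p.eval x ^ 2 with hI
  have hIs : I = ∑ α, ω α * p.eval (ξ α) ^ 2 := by
    have := hG.exact (p ^ 2) (Polynomial.natDegree_pow_le.trans (by omega))
    simpa using this
  have hnode : ∀ α, |p.eval (ξ α)| ≤ 1 / √(ω α) * √I := fun α => by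
    have hω := hG.weight_pos α
    have h3 : ω α * p.eval (ξ α) ^ 2 ≤ I := by
      rw [hIs]
      exact Finset.single_le_sum (f := fun α => ω α * p.eval (ξ α) ^ 2)
        (fun β _ => mul_nonneg (hG.weight_pos β).le (sq_nonneg _)) (Finset.mem_univ α)
    rw [one_div, inv_mul_eq_div, ← Real.sqrt_div' _ hω.le]
    refine Real.abs_le_sqrt ?_
    rw [le_div_iff₀ hω]; linarith
  have hrep : ∀ t, p.eval t = ∑ α, p.eval (ξ α) * (Lagrange.basis Finset.univ ξ α).eval t := by
    intro t
    have hd : p.degree < (Finset.univ : Finset (Fin (k + 1))).card := by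
      rw [Finset.card_univ, Fintype.card_fin]
      exact (Polynomial.degree_le_natDegree).trans_lt
        (by exact_mod_cast Nat.lt_succ_of_le hp)
    conv_lhs => rw [Lagrange.eq_interpolate hG.injective.injOn hd]
    simp [Lagrange.interpolate_apply, Polynomial.eval_finsetSum]
  have hRk : 0 ≤ R ^ k := by positivity
  constructor
  · rw [hrep s, Finset.sum_mul, Finset.sum_mul]
    refine (Finset.abs_sum_le_sum_abs _ _).trans (Finset.sum_le_sum fun α _ => ?_)
    rw [abs_mul]
    have h4 : |(Lagrange.basis Finset.univ ξ α).eval s| ≤ (A₁ α + A₂ α) * R ^ k :=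
      (h₁ α R s hR hs).trans (by have := hA₂ α; gcongr; linarith)
    calc _ ≤ (1 / √(ω α) * √I) * ((A₁ α + A₂ α) * R ^ k) := by gcongr; exact hnode α
      _ = _ := by ring
  · rw [hrep s, hrep s', ← Finset.sum_sub_distrib, Finset.sum_mul, Finset.sum_mul, Finset.sum_mul]
    refine (Finset.abs_sum_le_sum_abs _ _).trans (Finset.sum_le_sum fun α _ => ?_)
    rw [← mul_sub, abs_mul]
    have h4 : |(Lagrange.basis Finset.univ ξ α).eval s - (Lagrange.basis Finset.univ ξ α).eval s'|
        ≤ (A₁ α + A₂ α) * R ^ k * |s - s'| :=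
      (h₂ α R s s' hR hs hs').trans (by have := hA₁ α; gcongr; linarith)
    calc _ ≤ (1 / √(ω α) * √I) * ((A₁ α + A₂ α) * R ^ k * |s - s'|) := by
          gcongr; exact hnode α
      _ = _ := by ring

/-- Inverse inequalities for squares of polynomials on a neighbourhood of an interval. -/
lemma IsGaussRule.exists_sq_bound (hG : IsGaussRule k ξ ω) :
    ∃ A, 0 ≤ A ∧ ∀ p : Polynomial ℝ, p.natDegree ≤ k → ∀ a h R z z', 0 < h → 1 ≤ R →
      |z - (a + h / 2)| ≤ R * (h / 2) → |z' - (a + h / 2)| ≤ R * (h / 2) →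
      p.eval z ^ 2 ≤ A * R ^ (2 * k) * ((∫ x in a..a + h, p.eval x ^ 2) / h) ∧
      |p.eval z ^ 2 - p.eval z' ^ 2| ≤
        A * R ^ (2 * k) * (|z - z'| / h) * ((∫ x in a..a + h, p.eval x ^ 2) / h) := by
  obtain ⟨B, hB, H⟩ := hG.exists_eval_bound
  refine ⟨8 * B ^ 2, by positivity, fun p hp a h R z z' hh hR hz hz' => ?_⟩
  set I := ∫ x in a..a + h, p.eval x ^ 2 with hI
  set P := p.comp (Polynomial.C (h / 2) * Polynomial.X + Polynomial.C (a + h / 2)) with hP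
  have hPd : P.natDegree ≤ k := by
    refine Polynomial.natDegree_comp_le.trans ?_
    exact (Nat.mul_le_mul_left _ (Polynomial.natDegree_linear_le)).trans (by omega)
  have hev : ∀ s, P.eval s = p.eval (h / 2 * s + (a + h / 2)) := fun s => by simp [hP]
  have hint : ∫ x in (-1 : ℝ)..1, P.eval x ^ 2 = 2 * (I / h) := by
    have h2 := intervalIntegral.smul_integral_comp_mul_add (a := -1) (b := 1)
      (fun x => p.eval x ^ 2) (h / 2) (a + h / 2)
    rw [show h / 2 * (-1) + (a + h / 2) = a by ring,
      show h / 2 * 1 + (a + h / 2) = a + h by ring, smul_eq_mul, ← hI] at h2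
    simp only [hev]
    generalize (∫ x in (-1 : ℝ)..1, p.eval (h / 2 * x + (a + h / 2)) ^ 2) = J at h2 ⊢
    rw [← h2]
    field_simp
  have hI0 : 0 ≤ I := intervalIntegral.integral_nonneg (by linarith) fun x _ => sq_nonneg _
  set S := √(∫ x in (-1 : ℝ)..1, P.eval x ^ 2) with hS
  have hS2 : S ^ 2 = 2 * (I / h) := by
    rw [hS, Real.sq_sqrt (by rw [hint]; positivity), hint]
  have hS0 : 0 ≤ S := Real.sqrt_nonneg _
  have habs : ∀ z, |z - (a + h / 2)| ≤ R * (h / 2) → |(z - (a + h / 2)) / (h / 2)| ≤ R :=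
    fun z hz => by rwa [abs_div, abs_of_pos (half_pos hh), div_le_iff₀ (half_pos hh)]
  have hback : ∀ z, P.eval ((z - (a + h / 2)) / (h / 2)) = p.eval z := fun z => by
    rw [hev]; congr 1; field_simp; ring
  obtain ⟨h1, h2⟩ := H P hPd R _ _ hR (habs z hz) (habs z' hz')
  obtain ⟨h1', -⟩ := H P hPd R _ _ hR (habs z' hz') (habs z hz)
  rw [hback] at h1 h1'
  rw [hback, hback, ← sub_div, sub_sub_sub_cancel_right, abs_div, abs_of_pos (half_pos hh)] at h2
  have hpow : R ^ (2 * k) = R ^ k * R ^ k := by rw [two_mul, pow_add]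
  have hRk : 0 ≤ R ^ k := by positivity
  constructor
  · rw [← sq_abs]
    calc |p.eval z| ^ 2 ≤ (B * R ^ k * S) ^ 2 := by gcongr
      _ = B ^ 2 * R ^ (2 * k) * S ^ 2 := by rw [hpow]; ring
      _ = 2 * B ^ 2 * R ^ (2 * k) * (I / h) := by rw [hS2]; ring
      _ ≤ _ := by gcongr; norm_num
  · rw [sq_sub_sq, abs_mul]
    have h3 : |p.eval z + p.eval z'| ≤ 2 * (B * R ^ k * S) := (abs_add_le _ _).trans (by linarith)
    calc _ ≤ (2 * (B * R ^ k * S)) * (B * R ^ k * (|z - z'| / (h / 2)) * S) := by gcongr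
      _ = 4 * B ^ 2 * R ^ (2 * k) * (|z - z'| / h) * S ^ 2 := by rw [hpow]; field_simp; ring
      _ = _ := by rw [hS2]; ring

end gauss

/-! ### The subintervals cut out by the crossings -/

section mesh

variable {w : ℝ → ℝ} {M : ℕ}

lemma mem_crossingFinset {i : ℕ} (h : (crossings w M i).Finite) {x : ℝ} :
    x ∈ crossingFinset w M i ↔ x ∈ crossings w M i := by
  simp [crossingFinset, h]

lemma breakpoint_zero (w : ℝ → ℝ) (M i : ℕ) : breakpoint w M i 0 = (i : ℝ) / M := rfl

lemma breakpoint_last (w : ℝ → ℝ) (M i : ℕ) :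
    breakpoint w M i ((crossingFinset w M i).card + 1) = ((i : ℝ) + 1) / M := by
  unfold breakpoint
  rw [List.getD_cons_succ, ← Finset.length_sort (· ≤ ·) (s := crossingFinset w M i),
    List.getD_append_right _ _ _ _ le_rfl]
  simp

lemma breakpoint_lt {i : ℕ} (hM : 1 ≤ M) (h : (crossings w M i).Finite) {q r : ℕ} (hqr : q < r)
    (hr : r ≤ (crossingFinset w M i).card + 1) : breakpoint w M i q < breakpoint w M i r := by
  have hM' : (0 : ℝ) < M := by exact_mod_cast hM
  have hpw : (((i : ℝ) / M) :: ((crossingFinset w M i).sort (· ≤ ·) ++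
      [((i : ℝ) + 1) / M])).Pairwise (· < ·) := by
    rw [List.pairwise_cons, List.pairwise_append]
    refine ⟨fun x hx => ?_, (Finset.sortedLT_sort _).pairwise, by simp, fun x hx z hz => ?_⟩
    · rcases List.mem_append.1 hx with hx | hx
      · exact ((mem_crossingFinset h).1 ((Finset.mem_sort _).1 hx)).1.1
      · rw [List.mem_singleton.1 hx]
        gcongr
        linarith
    · rw [List.mem_singleton.1 hz]
      exact ((mem_crossingFinset h).1 ((Finset.mem_sort _).1 hx)).1.2
  have hlen : (((i : ℝ) / M) :: ((crossingFinset w M i).sort (· ≤ ·) ++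
      [((i : ℝ) + 1) / M])).length =
      (crossingFinset w M i).card + 2 := by
    simp
  rw [List.pairwise_iff_getElem] at hpw
  have := hpw q r (by omega) (by omega) hqr
  unfold breakpoint
  rwa [List.getD_eq_getElem _ _ (by omega), List.getD_eq_getElem _ _ (by omega)]

lemma breakpoint_le {i : ℕ} (hM : 1 ≤ M) (h : (crossings w M i).Finite) {q r : ℕ} (hqr : q ≤ r)
    (hr : r ≤ (crossingFinset w M i).card + 1) : breakpoint w M i q ≤ breakpoint w M i r := by
  rcases hqr.eq_or_lt with rfl | hqr
  · rfl
  · exact (breakpoint_lt hM h hqr hr).le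

lemma exists_breakpoint_eq {i : ℕ} (h : (crossings w M i).Finite) {x : ℝ}
    (hx : x ∈ crossings w M i) :
    ∃ r ≤ (crossingFinset w M i).card + 1, breakpoint w M i r = x := by
  obtain ⟨n, hn, rfl⟩ := List.getElem_of_mem
    ((Finset.mem_sort (· ≤ ·)).2 ((mem_crossingFinset h).2 hx))
  rw [Finset.length_sort] at hn
  refine ⟨n + 1, by omega, ?_⟩
  unfold breakpoint
  rw [List.getD_cons_succ, List.getD_append _ _ _ _ (by rwa [Finset.length_sort]),
    List.getD_eq_getElem]

/-- Indices `(i, q)` of the subintervals. -/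
def subIdx (w : ℝ → ℝ) (M : ℕ) : Finset (Σ _ : ℕ, ℕ) :=
  (Finset.range M).sigma fun i => Finset.range ((crossingFinset w M i).card + 1)

/-- Left end of a subinterval. -/
def lft (w : ℝ → ℝ) (M : ℕ) (z : Σ _ : ℕ, ℕ) : ℝ := breakpoint w M z.1 z.2

/-- Right end of a subinterval. -/
def rgt (w : ℝ → ℝ) (M : ℕ) (z : Σ _ : ℕ, ℕ) : ℝ := breakpoint w M z.1 (z.2 + 1)

lemma mem_subIdx {z : Σ _ : ℕ, ℕ} :
    z ∈ subIdx w M ↔ z.1 < M ∧ z.2 < (crossingFinset w M z.1).card + 1 := by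
  simp [subIdx]

variable (hM : 1 ≤ M) (hfin : ∀ i < M, (crossings w M i).Finite)
include hM hfin

lemma lft_lt_rgt {z : Σ _ : ℕ, ℕ} (hz : z ∈ subIdx w M) : lft w M z < rgt w M z := by
  obtain ⟨h1, h2⟩ := mem_subIdx.1 hz
  exact breakpoint_lt hM (hfin _ h1) (Nat.lt_succ_self _) (by omega)

lemma le_lft {z : Σ _ : ℕ, ℕ} (hz : z ∈ subIdx w M) : (z.1 : ℝ) / M ≤ lft w M z := by
  obtain ⟨h1, h2⟩ := mem_subIdx.1 hz
  exact breakpoint_le hM (hfin _ h1) (Nat.zero_le _) (by omega)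

lemma rgt_le {z : Σ _ : ℕ, ℕ} (hz : z ∈ subIdx w M) : rgt w M z ≤ ((z.1 : ℝ) + 1) / M := by
  obtain ⟨h1, h2⟩ := mem_subIdx.1 hz
  rw [← breakpoint_last w]
  exact breakpoint_le hM (hfin _ h1) (by omega) le_rfl

lemma Ioo_subset_cell {z : Σ _ : ℕ, ℕ} (hz : z ∈ subIdx w M) :
    Set.Ioo (lft w M z) (rgt w M z) ⊆ cell M z.1 :=
  Set.Ioo_subset_Ioo (le_lft hM hfin hz) (rgt_le hM hfin hz)

lemma Icc_subset_unit {z : Σ _ : ℕ, ℕ} (hz : z ∈ subIdx w M) :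
    Set.Icc (lft w M z) (rgt w M z) ⊆ Set.Icc 0 1 := by
  have h1 := (mem_subIdx.1 hz).1
  have hM' : (0 : ℝ) < M := by exact_mod_cast hM
  refine Set.Icc_subset_Icc (le_trans (by positivity) (le_lft hM hfin hz))
    ((rgt_le hM hfin hz).trans ?_)
  rw [div_le_one hM']
  exact_mod_cast h1

lemma Ioo_subset_unit {z : Σ _ : ℕ, ℕ} (hz : z ∈ subIdx w M) :
    Set.Ioo (lft w M z) (rgt w M z) ⊆ Set.Ioo 0 1 := by
  have h := (Set.Icc_subset_Icc_iff (lft_lt_rgt hM hfin hz).le).1 (Icc_subset_unit hM hfin hz)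
  exact Set.Ioo_subset_Ioo h.1 h.2

lemma rgt_sub_lft_le {z : Σ _ : ℕ, ℕ} (hz : z ∈ subIdx w M) :
    rgt w M z - lft w M z ≤ 1 / M := by
  have h1 := le_lft hM hfin hz
  have h2 := rgt_le hM hfin hz
  rw [add_div] at h2
  linarith

omit hfin in
lemma cell_disjoint {i j : ℕ} {x : ℝ} (hi : x ∈ cell M i) (hj : x ∈ cell M j) : i = j := by
  have hM' : (0 : ℝ) < M := by exact_mod_cast hM
  have key : ∀ i j : ℕ, x ∈ cell M i → x ∈ cell M j → i ≤ j := fun i j hi hj => by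
    have h := hi.1.trans hj.2
    rw [div_lt_div_iff_of_pos_right hM'] at h
    exact Nat.lt_succ_iff.1 (by exact_mod_cast h)
  exact le_antisymm (key _ _ hi hj) (key _ _ hj hi)

lemma subinterval_disjoint {z z' : Σ _ : ℕ, ℕ} (hz : z ∈ subIdx w M) (hz' : z' ∈ subIdx w M)
    {x : ℝ} (hx : x ∈ Set.Ioo (lft w M z) (rgt w M z))
    (hx' : x ∈ Set.Ioo (lft w M z') (rgt w M z')) : z = z' := by
  have hi := cell_disjoint hM (Ioo_subset_cell hM hfin hz hx) (Ioo_subset_cell hM hfin hz' hx')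
  obtain ⟨i, q⟩ := z
  obtain ⟨i', q'⟩ := z'
  obtain rfl : i = i' := hi
  obtain ⟨h1, h2⟩ := mem_subIdx.1 hz
  obtain ⟨-, h2'⟩ := mem_subIdx.1 hz'
  simp only [lft, rgt] at hx hx' h1 h2 h2'
  have key : ∀ q q' : ℕ, q' < (crossingFinset w M i).card + 1 →
      x < breakpoint w M i (q + 1) → breakpoint w M i q' < x → q' ≤ q := fun q q' hq' ha hb => by
    by_contra! hlt
    have := breakpoint_le hM (hfin i h1) (Nat.succ_le_of_lt hlt) hq'.le
    linarith
  have := le_antisymm (key q' q h2 hx'.2 hx.1) (key q q' h2' hx.2 hx'.1)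
  rw [this]

lemma not_crossing {z : Σ _ : ℕ, ℕ} (hz : z ∈ subIdx w M) {x : ℝ}
    (hx : x ∈ Set.Ioo (lft w M z) (rgt w M z)) (l : ℤ) : w x ≠ (l : ℝ) / M := by
  intro hl
  obtain ⟨h1, h2⟩ := mem_subIdx.1 hz
  obtain ⟨r, hr, rfl⟩ := exists_breakpoint_eq (hfin _ h1)
    ⟨Ioo_subset_cell hM hfin hz hx, l, hl⟩
  rcases Nat.lt_or_ge z.2 r with h | h
  · exact absurd hx.2 (not_lt.2 (breakpoint_le hM (hfin _ h1) h hr))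
  · exact absurd hx.1 (not_lt.2 (breakpoint_le hM (hfin _ h1) h h2.le))

lemma exists_target_cell (hw : ContinuousOn w (Set.Icc 0 1)) {z : Σ _ : ℕ, ℕ}
    (hz : z ∈ subIdx w M) : ∃ j : ℤ, ∀ x ∈ Set.Ioo (lft w M z) (rgt w M z),
      (j : ℝ) / M < w x ∧ w x < ((j : ℝ) + 1) / M := by
  have hM' : (0 : ℝ) < M := by exact_mod_cast hM
  have hlr := lft_lt_rgt hM hfin hz
  have hmid : (lft w M z + rgt w M z) / 2 ∈ Set.Ioo (lft w M z) (rgt w M z) :=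
    ⟨by linarith, by linarith⟩
  set x₀ := (lft w M z + rgt w M z) / 2
  have hcast : ∀ l : ℤ, ((l : ℝ) + 1) / M = ((l + 1 : ℤ) : ℝ) / M := fun l => by push_cast; rfl
  refine ⟨⌊w x₀ * M⌋, fun x hx => ?_⟩
  have h1 : (⌊w x₀ * M⌋ : ℝ) / M ≤ w x₀ := by
    rw [div_le_iff₀ hM']; exact Int.floor_le _
  have h2 : w x₀ < ((⌊w x₀ * M⌋ : ℝ) + 1) / M := by
    rw [lt_div_iff₀ hM']; exact Int.lt_floor_add_one _
  have hsub : Set.uIcc x₀ x ⊆ Set.Ioo (lft w M z) (rgt w M z) :=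
    Set.OrdConnected.uIcc_subset Set.ordConnected_Ioo hmid hx
  have hivt := intermediate_value_uIcc (f := w) (hw.mono (hsub.trans
    (Set.Ioo_subset_Icc_self.trans (Icc_subset_unit hM hfin hz))))
  have key : ∀ l : ℤ, (l : ℝ) / M ∉ Set.uIcc (w x₀) (w x) := fun l hl => by
    obtain ⟨t, ht, hwt⟩ := hivt hl
    exact not_crossing hM hfin hz (hsub ht) l hwt
  constructor
  · by_contra! h
    exact key _ (Set.mem_uIcc.2 (Or.inr ⟨h, h1⟩))
  · by_contra! h
    rw [hcast] at h h2
    exact key _ (Set.mem_uIcc.2 (Or.inl ⟨h2.le, h⟩))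

lemma sum_integral_subIdx {g : ℝ → ℝ} (hg : IntervalIntegrable g MeasureTheory.volume 0 1) :
    ∑ z ∈ subIdx w M, ∫ x in lft w M z..rgt w M z, g x = ∫ x in (0 : ℝ)..1, g x := by
  have hM' : (0 : ℝ) < M := by exact_mod_cast hM
  have hint : ∀ a c, 0 ≤ a → a ≤ c → c ≤ 1 → IntervalIntegrable g MeasureTheory.volume a c :=
    fun a c h0 hac h1 => hg.mono_set (by
      rw [Set.uIcc_of_le hac, Set.uIcc_of_le zero_le_one]; exact Set.Icc_subset_Icc h0 h1)
  unfold subIdx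
  rw [Finset.sum_sigma]
  have hcell : ∀ i ∈ Finset.range M, (∑ q ∈ Finset.range ((crossingFinset w M i).card + 1),
      ∫ x in lft w M ⟨i, q⟩..rgt w M ⟨i, q⟩, g x) =
      ∫ x in (i : ℝ) / M..((i + 1 : ℕ) : ℝ) / M, g x := by
    intro i hi
    have := intervalIntegral.sum_integral_adjacent_intervals (f := g)
      (μ := MeasureTheory.volume) (a := breakpoint w M i)
      (n := (crossingFinset w M i).card + 1) fun q hq => by
        have hz : (⟨i, q⟩ : Σ _ : ℕ, ℕ) ∈ subIdx w M := mem_subIdx.2 ⟨Finset.mem_range.1 hi, hq⟩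
        have hlr := (lft_lt_rgt hM hfin hz).le
        have hs := (Set.Icc_subset_Icc_iff hlr).1 (Icc_subset_unit hM hfin hz)
        exact hint _ _ hs.1 hlr hs.2
    rw [breakpoint_zero, breakpoint_last] at this
    push_cast
    exact this
  rw [Finset.sum_congr rfl hcell]
  have := intervalIntegral.sum_integral_adjacent_intervals (f := g)
    (μ := MeasureTheory.volume) (a := fun i : ℕ => (i : ℝ) / M) (n := M) fun i hi => by
      refine hint _ _ (by positivity) (by gcongr; simp) ?_
      rw [div_le_one hM']
      exact_mod_cast hi
  rw [this]
  simp [hM'.ne']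

omit hM hfin in
lemma gaussForm_eq_sum {k : ℕ} (ξ ω : Fin (k + 1) → ℝ) (u φ : ℝ → ℝ) :
    gaussForm ξ ω M w u φ = ∑ z ∈ subIdx w M, ∑ α, ω α / 2 * (rgt w M z - lft w M z) *
      u (w (node w M z.1 z.2 (ξ α))) * φ (node w M z.1 z.2 (ξ α)) := by
  unfold gaussForm subIdx
  rw [Finset.sum_sigma]
  rfl

lemma node_mem {z : Σ _ : ℕ, ℕ} (hz : z ∈ subIdx w M) {s : ℝ} (hs : s ∈ Set.Ioo (-1 : ℝ) 1) :
    node w M z.1 z.2 s ∈ Set.Ioo (lft w M z) (rgt w M z) := by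
  have h := lft_lt_rgt hM hfin hz
  obtain ⟨h1, h2⟩ := hs
  have e : node w M z.1 z.2 s = lft w M z + (1 + s) / 2 * (rgt w M z - lft w M z) := rfl
  rw [e]
  constructor <;> nlinarith

end mesh

open MeasureTheory in
lemma sum_integral_le_of_disjoint {ι : Type*} (s : Finset ι) {l r : ι → ℝ} {A B : ℝ} {f : ℝ → ℝ}
    (hf : Continuous f) (hf0 : ∀ x, 0 ≤ f x) (hAB : A ≤ B) (hlr : ∀ i ∈ s, l i ≤ r i)
    (hsub : ∀ i ∈ s, Set.Ioo (l i) (r i) ⊆ Set.Ioo A B)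
    (hdisj : ∀ i ∈ s, ∀ j ∈ s, ∀ x, x ∈ Set.Ioo (l i) (r i) → x ∈ Set.Ioo (l j) (r j) → i = j) :
    ∑ i ∈ s, ∫ x in l i..r i, f x ≤ ∫ x in A..B, f x := by
  have hI : ∀ a c, IntegrableOn f (Set.Ioo a c) := fun a c =>
    (hf.integrableOn_Icc (a := a) (b := c)).mono_set Set.Ioo_subset_Icc_self
  have e : ∀ i ∈ s, ∫ x in l i..r i, f x = ∫ x in Set.Ioo (l i) (r i), f x := fun i hi => by
    rw [intervalIntegral.integral_of_le (hlr i hi), integral_Ioc_eq_integral_Ioo]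
  rw [Finset.sum_congr rfl e, intervalIntegral.integral_of_le hAB, integral_Ioc_eq_integral_Ioo,
    ← integral_biUnion_finset s (fun _ _ => measurableSet_Ioo) ?_ fun i _ => hI _ _]
  · exact setIntegral_mono_set (hI _ _) (Filter.Eventually.of_forall hf0)
      (Set.iUnion₂_subset hsub).eventuallyLE
  · intro i hi j hj hij
    rw [Function.onFun, Set.disjoint_left]
    exact fun x hx hx' => hij (hdisj i hi j hj x hx hx')

/-! ### Functions that are continuous on each cell -/

/-- On every cell, `f` agrees with a continuous function. -/
def IsCellwiseContinuous (M : ℕ) (f : ℝ → ℝ) : Prop :=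
  ∀ i < M, ∃ g : ℝ → ℝ, Continuous g ∧ ∀ x ∈ cell M i, f x = g x

section cellwise

variable {M : ℕ} {f g : ℝ → ℝ}

lemma IsCellwiseContinuous.mul (hf : IsCellwiseContinuous M f) (hg : IsCellwiseContinuous M g) :
    IsCellwiseContinuous M fun x => f x * g x := fun i hi => by
  obtain ⟨f', cf, hf'⟩ := hf i hi
  obtain ⟨g', cg, hg'⟩ := hg i hi
  exact ⟨_, cf.mul cg, fun x hx => congrArg₂ (· * ·) (hf' x hx) (hg' x hx)⟩

lemma IsCellwiseContinuous.sub (hf : IsCellwiseContinuous M f) (hg : IsCellwiseContinuous M g) :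
    IsCellwiseContinuous M fun x => f x - g x := fun i hi => by
  obtain ⟨f', cf, hf'⟩ := hf i hi
  obtain ⟨g', cg, hg'⟩ := hg i hi
  exact ⟨_, cf.sub cg, fun x hx => congrArg₂ (· - ·) (hf' x hx) (hg' x hx)⟩

lemma IsCellwiseContinuous.sq (hf : IsCellwiseContinuous M f) :
    IsCellwiseContinuous M fun x => f x ^ 2 := by
  simpa only [pow_two] using hf.mul hf

lemma isCellwiseContinuous_of_continuous (hf : Continuous f) : IsCellwiseContinuous M f :=
  fun _ _ => ⟨f, hf, fun _ _ => rfl⟩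

lemma IsDG.isCellwiseContinuous {k : ℕ} (hf : IsDG k M f) : IsCellwiseContinuous M f :=
  fun i hi => by
    obtain ⟨p, -, hp⟩ := hf.2 i hi
    exact ⟨_, p.continuous, hp⟩

lemma IsCellwiseContinuous.intervalIntegrable (hM : 1 ≤ M) (hf : IsCellwiseContinuous M f) :
    IntervalIntegrable f MeasureTheory.volume 0 1 := by
  have hM' : (0 : ℝ) < M := by exact_mod_cast hM
  have := IntervalIntegrable.trans_iterate (f := f) (μ := MeasureTheory.volume)
    (a := fun i : ℕ => (i : ℝ) / M) (n := M) fun i hi => by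
      obtain ⟨g, cg, hg⟩ := hf i hi
      refine (cg.intervalIntegrable _ _).congr_uIoo fun x hx => (hg x ?_).symm
      have hle : (i : ℝ) / M ≤ ((i + 1 : ℕ) : ℝ) / M := by gcongr; simp
      rw [Set.uIoo_of_le hle] at hx
      simpa [cell] using hx
  simpa [hM'.ne'] using this

lemma IsCellwiseContinuous.integral_eq_sum (hM : 1 ≤ M) (hf : IsCellwiseContinuous M f) :
    ∫ x in (0 : ℝ)..1, f x = ∑ i ∈ Finset.range M,
      ∫ x in (i : ℝ) / M..(i : ℝ) / M + 1 / M, f x := by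
  have hM' : (0 : ℝ) < M := by exact_mod_cast hM
  have hle : ∀ i : ℕ, (i : ℝ) / M ≤ ((i + 1 : ℕ) : ℝ) / M := fun i => by gcongr; simp
  have := intervalIntegral.sum_integral_adjacent_intervals (f := f) (μ := MeasureTheory.volume)
    (a := fun i : ℕ => (i : ℝ) / M) (n := M) fun i hi => by
      refine (hf.intervalIntegrable hM).mono_set ?_
      rw [Set.uIcc_of_le (hle i), Set.uIcc_of_le zero_le_one]
      refine Set.Icc_subset_Icc (by positivity) ?_
      rw [div_le_one hM']
      exact_mod_cast hi
  simp only [Nat.cast_zero, zero_div, div_self hM'.ne'] at this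
  rw [← this]
  refine Finset.sum_congr rfl fun i _ => ?_
  rw [← add_div]
  push_cast
  rfl

end cellwise

/-- A discontinuous Galerkin function is a translated polynomial on the cells of all of `ℝ`. -/
lemma IsDG.eq_eval {k M : ℕ} (hM : 1 ≤ M) {e : ℝ → ℝ} (he : IsDG k M e) {i : ℕ} {m j : ℤ}
    (hj : j = i + M * m) {p : Polynomial ℝ} (hp : ∀ x ∈ cell M i, e x = p.eval x)
    {x : ℝ} (h1 : (j : ℝ) / M < x) (h2 : x < ((j : ℝ) + 1) / M) :
    x - m ∈ cell M i ∧ e x = p.eval (x - m) := by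
  have hM' : (0 : ℝ) < M := by exact_mod_cast hM
  have hx : x - m ∈ cell M i := by
    rw [div_lt_iff₀ hM'] at h1
    rw [lt_div_iff₀ hM'] at h2
    rw [hj] at h1 h2
    push_cast at h1 h2
    refine ⟨?_, ?_⟩
    · rw [div_lt_iff₀ hM']; linarith
    · rw [lt_div_iff₀ hM']; linarith
  refine ⟨hx, ?_⟩
  rw [← hp _ hx]
  have := he.1.sub_int_mul_eq (x := x) m
  rw [mul_one] at this
  exact this.symm

/-! ### Stability of one step -/

lemma integral_enlarged_le {A : ℝ} (hA : 0 ≤ A) {k : ℕ} {p : Polynomial ℝ} {a h ε η R : ℝ}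
    (hh : 0 < h) (hη : 0 ≤ η) (hε : 0 ≤ ε) (hεη : ε ≤ η * h) (hR : R = 1 + 2 * η)
    (hp : ∀ z, |z - (a + h / 2)| ≤ R * (h / 2) →
      p.eval z ^ 2 ≤ A * R ^ (2 * k) * ((∫ x in a..a + h, p.eval x ^ 2) / h)) :
    ∫ z in a - ε..a + h + ε, (p.eval z ^ 2 +
        2 * (A * R ^ (2 * k) * η * ((∫ x in a..a + h, p.eval x ^ 2) / h))) ≤
      R ^ (2 * k + 1 + ⌈2 * A⌉₊) * ∫ x in a..a + h, p.eval x ^ 2 := by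
  set I := ∫ x in a..a + h, p.eval x ^ 2 with hI
  have hI0 : 0 ≤ I := intervalIntegral.integral_nonneg (by linarith) fun x _ => sq_nonneg _
  have hR1 : 1 ≤ R := by linarith
  have hc : Continuous fun z => p.eval z ^ 2 := by fun_prop
  set Q := A * R ^ (2 * k) * (I / h) with hQ
  have hQ0 : 0 ≤ Q := by positivity
  have hQh : Q * h = A * R ^ (2 * k) * I := by rw [hQ]; field_simp
  have hflank : ∀ c d, c ≤ d → a - ε ≤ c → d ≤ a + h + ε →
      ∫ z in c..d, p.eval z ^ 2 ≤ Q * (d - c) := fun c d hcd h1 h2 => by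
    have := intervalIntegral.integral_mono_on hcd (hc.intervalIntegrable _ _)
      (g := fun _ => Q) (μ := MeasureTheory.volume) intervalIntegrable_const fun z hz => by
        refine hp z (abs_le.2 ⟨?_, ?_⟩) <;> rw [hR] <;> nlinarith [hz.1, hz.2]
    simpa [mul_comm] using this
  have hsplit : ∫ z in a - ε..a + h + ε, p.eval z ^ 2 ≤ Q * ε + I + Q * ε := by
    rw [← intervalIntegral.integral_add_adjacent_intervals (b := a + h)
      (hc.intervalIntegrable _ _) (hc.intervalIntegrable _ _),
      ← intervalIntegral.integral_add_adjacent_intervals (a := a - ε) (b := a)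
      (hc.intervalIntegrable _ _) (hc.intervalIntegrable _ _)]
    have h1 := hflank (a - ε) a (by linarith) le_rfl (by linarith)
    have h2 := hflank (a + h) (a + h + ε) (by linarith) (by linarith) le_rfl
    rw [show a - (a - ε) = ε by ring] at h1
    rw [show a + h + ε - (a + h) = ε by ring] at h2
    linarith
  rw [intervalIntegral.integral_add (hc.intervalIntegrable _ _) (by simp),
    intervalIntegral.integral_const, smul_eq_mul,
    show a + h + ε - (a - ε) = h + 2 * ε by ring,
    show A * R ^ (2 * k) * η * (I / h) = Q * η by rw [hQ]; ring]
  have hN : 1 + (⌈2 * A⌉₊ : ℝ) * (2 * η) ≤ R ^ ⌈2 * A⌉₊ := by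
    rw [hR]
    exact one_add_mul_le_pow (by linarith) _
  have hN2 : 2 * A * (2 * η) ≤ (⌈2 * A⌉₊ : ℝ) * (2 * η) := by
    gcongr
    exact Nat.le_ceil _
  have hRk : 1 ≤ R ^ (2 * k) := one_le_pow₀ hR1
  have hRk1 : R ^ (2 * k + 1) = R ^ (2 * k) * R := pow_succ _ _
  have h1R : 1 ≤ R ^ (2 * k + 1) := one_le_pow₀ hR1
  calc _ ≤ (Q * ε + I + Q * ε) + (h + 2 * ε) * (2 * (Q * η)) := by gcongr
    _ ≤ (Q * (η * h) + I + Q * (η * h)) + (h + 2 * (η * h)) * (2 * (Q * η)) := by gcongr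
    _ = I + 2 * η * (Q * h) + 2 * η * R * (Q * h) := by rw [hR]; ring
    _ = I + 2 * η * (A * R ^ (2 * k) * I) * (1 + R) := by rw [hQh]; ring
    _ ≤ I + 2 * η * (A * R ^ (2 * k) * I) * (R + R) := by gcongr
    _ = I + 4 * η * A * R ^ (2 * k + 1) * I := by rw [hRk1]; ring
    _ ≤ R ^ (2 * k + 1) * I + 4 * η * A * R ^ (2 * k + 1) * I := by
      have := le_mul_of_one_le_left hI0 h1R
      linarith
    _ = R ^ (2 * k + 1) * (1 + 2 * A * (2 * η)) * I := by ring
    _ ≤ R ^ (2 * k + 1) * R ^ ⌈2 * A⌉₊ * I := by gcongr; linarith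
    _ = _ := by rw [← pow_add]

section step

variable {k : ℕ} {ξ ω : Fin (k + 1) → ℝ}

lemma IsGaussRule.sum_mul_const (hG : IsGaussRule k ξ ω) (c d : ℝ) :
    ∑ α, ω α / 2 * c * d = c * d := by
  rw [← Finset.sum_mul, ← Finset.sum_mul, ← Finset.sum_div, hG.sum_weight]
  ring

/-- The quadrature of a squared polynomial along an approximate characteristic on a subinterval,
compared with an integral along the exact characteristic `X`. -/
lemma IsGaussRule.sum_sq_le_integral (hG : IsGaussRule k ξ ω) {A : ℝ} {p : Polynomial ℝ}
    (hpd : p.natDegree ≤ k) {a h ε η R : ℝ} (hη : 0 ≤ η)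
    (hεη : ε ≤ η * h) (hA : 0 ≤ A) (hh : 0 < h) (hR : R = 1 + 2 * η)
    (hp : ∀ z z', |z - (a + h / 2)| ≤ R * (h / 2) → |z' - (a + h / 2)| ≤ R * (h / 2) →
      |p.eval z ^ 2 - p.eval z' ^ 2| ≤
        A * R ^ (2 * k) * (|z - z'| / h) * ((∫ x in a..a + h, p.eval x ^ 2) / h))
    {w X : ℝ → ℝ} (hX : Continuous X) {l r m : ℝ} (hlr : l < r)
    (hw : ∀ x ∈ Set.Ioo l r, w x - m ∈ Set.Ioo a (a + h))
    (hwX : ∀ x ∈ Set.Ioo l r, |w x - X x| ≤ ε)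
    (hdisp : ∀ x ∈ Set.Ioo l r, |w x - (x + (X l - l))| ≤ η * h)
    (hdisp' : ∀ x ∈ Set.Ioo l r, |(x + (X l - l)) - X x| ≤ η * h) :
    ∑ α, ω α / 2 * (r - l) * p.eval (w (l + (1 + ξ α) / 2 * (r - l)) - m) ^ 2 ≤
      ∫ x in l..r, (p.eval (X x - m) ^ 2 +
        2 * (A * R ^ (2 * k) * η * ((∫ x in a..a + h, p.eval x ^ 2) / h))) := by
  set I := ∫ x in a..a + h, p.eval x ^ 2 with hI
  have hI0 : 0 ≤ I := intervalIntegral.integral_nonneg (by linarith) fun x _ => sq_nonneg _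
  have hR1 : 1 ≤ R := by linarith
  set δ := A * R ^ (2 * k) * η * (I / h) with hδ
  set s := X l - l with hs
  have hdiff : ∀ z z', |z - (a + h / 2)| ≤ R * (h / 2) → |z' - (a + h / 2)| ≤ R * (h / 2) →
      |z - z'| ≤ η * h → p.eval z ^ 2 ≤ p.eval z' ^ 2 + δ := fun z z' hz hz' hzz => by
    have h1 := (le_abs_self _).trans (hp z z' hz hz')
    have h2 : |z - z'| / h ≤ η := by rwa [div_le_iff₀ hh]
    have h3 : A * R ^ (2 * k) * (|z - z'| / h) * (I / h) ≤ δ := by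
      rw [hδ]; gcongr
    linarith
  have near : ∀ z z', z - m ∈ Set.Ioo a (a + h) → |z - z'| ≤ η * h →
      |z' - m - (a + h / 2)| ≤ R * (h / 2) := fun z z' hz hzz => by
    have := abs_le.1 hzz
    refine abs_le.2 ⟨?_, ?_⟩ <;> rw [hR] <;> nlinarith [hz.1, hz.2, this.1, this.2]
  have nη : 0 ≤ η * h := by positivity
  set P : Polynomial ℝ := (p ^ 2).comp (Polynomial.X + Polynomial.C (s - m)) with hP
  have hPd : P.natDegree ≤ 2 * k + 1 := by
    refine Polynomial.natDegree_comp_le.trans ?_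
    rw [Polynomial.natDegree_X_add_C, mul_one]
    exact Polynomial.natDegree_pow_le.trans (by omega)
  have hPe : ∀ x, P.eval x = p.eval (x + s - m) ^ 2 := fun x => by
    simp [hP, add_sub_assoc]
  have hnode : ∀ α, l + (1 + ξ α) / 2 * (r - l) ∈ Set.Ioo l r := fun α => by
    obtain ⟨h1, h2⟩ := hG.mem α
    constructor <;> nlinarith
  calc _ ≤ ∑ α, (ω α / 2 * (r - l) * P.eval (l + (1 + ξ α) / 2 * (r - l)) +
        ω α / 2 * (r - l) * δ) := by
        refine Finset.sum_le_sum fun α _ => ?_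
        have hω := hG.weight_pos α
        rw [← mul_add, hPe]
        have hx := hnode α
        have : 0 ≤ r - l := by linarith
        refine mul_le_mul_of_nonneg_left ?_ (by positivity)
        refine hdiff _ _ (near _ _ (hw _ hx) (by simpa using nη)) ?_ ?_
        · exact near _ _ (hw _ hx) (hdisp _ hx)
        · rw [sub_sub_sub_cancel_right]; exact hdisp _ hx
    _ = ∫ x in l..r, (P.eval x + δ) := by
        rw [Finset.sum_add_distrib, hG.integral_eq hPd, hG.sum_mul_const,
          intervalIntegral.integral_add (P.continuous.intervalIntegrable _ _) (by simp)]
        simp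
    _ ≤ _ := by
        refine intervalIntegral.integral_mono_on_of_le_Ioo hlr.le
          (Continuous.intervalIntegrable (by fun_prop) _ _)
          (Continuous.intervalIntegrable (by fun_prop) _ _) fun x hx => ?_
        rw [hPe]
        have := hdiff (x + s - m) (X x - m) (near _ _ (hw _ hx) (hdisp _ hx))
          (near _ _ (hw _ hx) ((hwX _ hx).trans hεη))
          (by rw [sub_sub_sub_cancel_right]; exact hdisp' _ hx)
        linarith

end step

lemma exists_stability {k : ℕ} {ξ ω : Fin (k + 1) → ℝ} (hG : IsGaussRule k ξ ω) {b : ℝ → ℝ}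
    (hb : ContDiff ℝ 1 b) (hper : Function.Periodic b 1) {y : ℝ → ℝ → ℝ}
    (hy : IsCharacteristicFlow b y) {L : ℝ} (hL : ∀ x, |deriv b x| ≤ L) {K : ℝ} (hK : 0 ≤ K) :
    ∃ c, 0 ≤ c ∧ ∀ (M : ℕ) (τ ε : ℝ) (w e : ℝ → ℝ), 1 ≤ M → 0 < τ →
      ContinuousOn w (Set.Icc 0 1) → (∀ i < M, (crossings w M i).Finite) →
      (∀ x ∈ Set.Icc (0 : ℝ) 1, |w x - y x (-τ)| ≤ ε) → ε ≤ K * (1 / M * τ) → IsDG k M e →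
      ∑ z ∈ subIdx w M, ∑ α, ω α / 2 * (rgt w M z - lft w M z) *
        e (w (node w M z.1 z.2 (ξ α))) ^ 2 ≤ Real.exp (c * τ) * ∫ x in (0 : ℝ)..1, e x ^ 2 := by
  obtain ⟨A, hA, hbound⟩ := hG.exists_sq_bound
  have hL0 : 0 ≤ L := (abs_nonneg _).trans (hL 0)
  set n := 2 * k + 1 + ⌈2 * A⌉₊ with hn
  refine ⟨L + n * (2 * (K + L)), by positivity, ?_⟩
  intro M τ ε w e hM hτ hwc hfin hwy hεK he
  have hM' : (0 : ℝ) < M := by exact_mod_cast hM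
  set h : ℝ := 1 / M with hh
  have hh0 : 0 < h := by positivity
  have hε : 0 ≤ ε := (abs_nonneg _).trans (hwy 0 ⟨le_rfl, zero_le_one⟩)
  have hexp : 0 ≤ Real.exp (L * τ) - 1 := by
    have := Real.one_le_exp (mul_nonneg hL0 hτ.le); linarith
  set η : ℝ := K * τ + (Real.exp (L * τ) - 1) with hη
  have hη0 : 0 ≤ η := by positivity
  have hεη : ε ≤ η * h := by
    rw [hη, add_mul]
    have := mul_nonneg hexp hh0.le
    linarith
  set R : ℝ := 1 + 2 * η with hR
  have hR1 : 1 ≤ R := by linarith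
  set X : ℝ → ℝ := fun x => y x (-τ) with hX
  have hXc : Continuous X :=
    (hy.continuous_uncurry hb hL).comp (continuous_const.prodMk continuous_id)
  -- the polynomials of `e`, and the target cell of each subinterval
  have hpoly : ∀ i, ∃ p : Polynomial ℝ, i < M → p.natDegree ≤ k ∧ ∀ x ∈ cell M i, e x = p.eval x :=
    fun i => by
      by_cases hi : i < M
      · obtain ⟨p, hp⟩ := he.2 i hi
        exact ⟨p, fun _ => hp⟩
      · exact ⟨0, fun h => absurd h hi⟩
  choose p hp using hpoly
  have htarget : ∀ z, ∃ j : ℤ, z ∈ subIdx w M → ∀ x ∈ Set.Ioo (lft w M z) (rgt w M z),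
      (j : ℝ) / M < w x ∧ w x < ((j : ℝ) + 1) / M := fun z => by
    by_cases hz : z ∈ subIdx w M
    · obtain ⟨j, hj⟩ := exists_target_cell hM hfin hwc hz
      exact ⟨j, fun _ => hj⟩
    · exact ⟨0, fun h => absurd h hz⟩
  choose j hj using htarget
  set ρ : (Σ _ : ℕ, ℕ) → ℕ := fun z => (j z % M).toNat with hρ
  set m : (Σ _ : ℕ, ℕ) → ℤ := fun z => j z / M with hm
  have hMz : (0 : ℤ) < M := by exact_mod_cast hM
  have hρcast : ∀ z, (ρ z : ℤ) = j z % M := fun z => Int.toNat_of_nonneg (Int.emod_nonneg _ hMz.ne')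
  have hρM : ∀ z, ρ z < M := fun z => by
    have h1 := Int.emod_lt_of_pos (j z) hMz
    rw [← hρcast] at h1
    exact_mod_cast h1
  have hjdecomp : ∀ z, j z = ρ z + M * m z := fun z => by
    rw [hρcast]; exact (Int.emod_add_mul_ediv _ _).symm
  have hev : ∀ z ∈ subIdx w M, ∀ x ∈ Set.Ioo (lft w M z) (rgt w M z),
      w x - m z ∈ cell M (ρ z) ∧ e (w x) = (p (ρ z)).eval (w x - m z) := fun z hz x hx =>
    he.eq_eval hM (hjdecomp z) (hp _ (hρM z)).2 (hj z hz x hx).1 (hj z hz x hx).2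
  have hcell : ∀ i : ℕ, cell M i = Set.Ioo ((i : ℝ) / M) ((i : ℝ) / M + h) := fun i => by
    rw [cell, add_div]
  set I : ℕ → ℝ := fun i => ∫ x in (i : ℝ) / M..(i : ℝ) / M + h, (p i).eval x ^ 2 with hI
  have hI0 : ∀ i, 0 ≤ I i := fun i =>
    intervalIntegral.integral_nonneg (by linarith) fun x _ => sq_nonneg _
  set g : ℕ → ℝ → ℝ := fun i z =>
    (p i).eval z ^ 2 + 2 * (A * R ^ (2 * k) * η * (I i / h)) with hg
  have hgc : ∀ i, Continuous (g i) := fun i => by rw [hg]; fun_prop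
  have hg0 : ∀ i x, 0 ≤ g i x := fun i x => by
    have := hI0 i
    rw [hg]
    positivity
  -- comparison on one subinterval
  have hlocal : ∀ z ∈ subIdx w M, ∑ α, ω α / 2 * (rgt w M z - lft w M z) *
      e (w (node w M z.1 z.2 (ξ α))) ^ 2 ≤
      ∫ x in lft w M z - m z..rgt w M z - m z, g (ρ z) (X x) := by
    intro z hz
    have hsub := (Ioo_subset_unit hM hfin hz).trans Set.Ioo_subset_Icc_self
    have hwX : ∀ x ∈ Set.Ioo (lft w M z) (rgt w M z), |w x - X x| ≤ ε := fun x hx =>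
      hwy x (hsub hx)
    have hdisp' : ∀ x ∈ Set.Ioo (lft w M z) (rgt w M z),
        |(x + (X (lft w M z) - lft w M z)) - X x| ≤ (Real.exp (L * τ) - 1) * h := fun x hx => by
      have h1 := hy.abs_displacement_sub_le hb hL (lft w M z) x (-τ)
      rw [abs_neg, abs_of_pos hτ, abs_of_pos (sub_pos.2 hx.1)] at h1
      rw [abs_sub_comm]
      have h2 : x - lft w M z ≤ h := by
        have := rgt_sub_lft_le hM hfin hz
        linarith [hx.2]
      calc _ = |y x (-τ) - x - (y (lft w M z) (-τ) - lft w M z)| := by congr 1; ring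
        _ ≤ _ := h1
        _ ≤ _ := by gcongr
    have key := hG.sum_sq_le_integral (hp _ (hρM z)).1 (a := (ρ z : ℝ) / M) hη0 hεη hA hh0 hR
      (fun u v hu hv => (hbound _ (hp _ (hρM z)).1 _ h R u v hh0 hR1 hu hv).2) hXc (m := m z)
      (lft_lt_rgt hM hfin hz) (fun x hx => by rw [← hcell]; exact (hev z hz x hx).1) hwX
      (fun x hx => by
        have h1 := abs_le.1 (hwX x hx)
        have h2 := abs_le.1 (hdisp' x hx)
        have h3 : η * h = K * (h * τ) + (Real.exp (L * τ) - 1) * h := by rw [hη]; ring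
        exact abs_le.2 ⟨by linarith, by linarith⟩)
      (fun x hx => (hdisp' x hx).trans (by gcongr; rw [hη]; linarith [mul_nonneg hK hτ.le]))
    calc _ = _ := Finset.sum_congr rfl fun α _ => by
          rw [(hev z hz _ (node_mem hM hfin hz (hG.mem α))).2]
          rfl
      _ ≤ _ := key
      _ = ∫ x in lft w M z..rgt w M z, g (ρ z) (X (x - m z)) := by
          refine intervalIntegral.integral_congr fun x _ => ?_
          have : X (x - m z) = X x - m z := by
            have := hy.add_int hb hper x (-τ) (-(m z))
            push_cast at this
            simpa [hX, sub_eq_add_neg] using this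
          simp only [hg, this]
          rfl
      _ = _ := intervalIntegral.integral_comp_sub_right (fun x => g (ρ z) (X x)) _
  -- the subintervals sent to one cell
  have hfiber : ∀ i ∈ Finset.range M, ∑ z ∈ subIdx w M with ρ z = i,
      ∫ x in lft w M z - m z..rgt w M z - m z, g (ρ z) (X x) ≤
      Real.exp (L * τ) * (R ^ n * I i) := by
    intro i hi
    have hiM := Finset.mem_range.1 hi
    have h1 : ∑ z ∈ subIdx w M with ρ z = i,
        ∫ x in lft w M z - m z..rgt w M z - m z, g (ρ z) (X x) =
        ∑ z ∈ subIdx w M with ρ z = i,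
        ∫ x in lft w M z - m z..rgt w M z - m z, g i (X x) :=
      Finset.sum_congr rfl fun z hz => by rw [(Finset.mem_filter.1 hz).2]
    have hle : (i : ℝ) / M - ε ≤ (i : ℝ) / M + h + ε := by linarith
    have h2 := sum_integral_le_of_disjoint (f := fun x => g i (X x))
      ((subIdx w M).filter fun z => ρ z = i) (l := fun z => lft w M z - m z)
      (r := fun z => rgt w M z - m z) (A := y ((i : ℝ) / M - ε) τ)
      (B := y ((i : ℝ) / M + h + ε) τ) ((hgc i).comp hXc) (fun x => hg0 i _)
      ((hy.strictMono hb τ).monotone hle)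
      (fun z hz => by
        have := lft_lt_rgt hM hfin (Finset.mem_filter.1 hz).1
        linarith)
      (fun z hz x hx => by
        obtain ⟨hz, hzi⟩ := Finset.mem_filter.1 hz
        have hx' : x + m z ∈ Set.Ioo (lft w M z) (rgt w M z) :=
          ⟨by linarith [hx.1], by linarith [hx.2]⟩
        have hc := (hev z hz _ hx').1
        have ha := abs_le.1 (hwy _ (Icc_subset_unit hM hfin hz (Set.Ioo_subset_Icc_self hx')))
        rw [hzi, hcell] at hc
        rw [hy.add_int hb hper] at ha
        have hback := hy.flow_flow_neg hb x τ
        constructor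
        · rw [← hback]
          exact hy.strictMono hb τ (by linarith [hc.1, ha.2])
        · rw [← hback]
          exact hy.strictMono hb τ (by linarith [hc.2, ha.1]))
      (fun z hz z' hz' x hx hx' => by
        obtain ⟨hz, -⟩ := Finset.mem_filter.1 hz
        obtain ⟨hz', -⟩ := Finset.mem_filter.1 hz'
        have hx1 : x + m z ∈ Set.Ioo (lft w M z) (rgt w M z) :=
          ⟨by linarith [hx.1], by linarith [hx.2]⟩
        have hx2 : x + m z' ∈ Set.Ioo (lft w M z') (rgt w M z') :=
          ⟨by linarith [hx'.1], by linarith [hx'.2]⟩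
        have hu1 := Ioo_subset_unit hM hfin hz hx1
        have hu2 := Ioo_subset_unit hM hfin hz' hx2
        have hmm : m z = m z' := by
          have a1 : (m z : ℝ) < m z' + 1 := by linarith [hu1.2, hu2.1]
          have a2 : (m z' : ℝ) < m z + 1 := by linarith [hu2.2, hu1.1]
          exact le_antisymm (Int.lt_add_one_iff.1 (by exact_mod_cast a1))
            (Int.lt_add_one_iff.1 (by exact_mod_cast a2))
        rw [← hmm] at hx2
        exact subinterval_disjoint hM hfin hz hz' hx1 hx2)
    have h3 := hy.integral_comp_le hb hL (hgc i) (hg0 i) hle τ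
    rw [abs_of_pos hτ] at h3
    have h4 := integral_enlarged_le (p := p i) (a := (i : ℝ) / M) hA hh0 hη0 hε hεη hR
      (k := k) fun z hz => (hbound _ (hp _ hiM).1 _ h R z z hh0 hR1 hz hz).1
    rw [h1]
    refine h2.trans (h3.trans ?_)
    gcongr
  have hsum : ∑ i ∈ Finset.range M, I i = ∫ x in (0 : ℝ)..1, e x ^ 2 := by
    rw [he.isCellwiseContinuous.sq.integral_eq_sum hM]
    refine Finset.sum_congr rfl fun i hi => ?_
    refine (intervalIntegral.integral_congr_Ioo_of_le (by linarith) fun x hx => ?_).symm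
    rw [← hcell] at hx
    simp only [(hp i (Finset.mem_range.1 hi)).2 x hx]
  have hRexp : R ≤ Real.exp (2 * (K + L) * τ) := by
    have h1 : 1 + η ≤ Real.exp ((K + L) * τ) := by
      have e1 : K * τ + 1 ≤ Real.exp (K * τ) := Real.add_one_le_exp _
      have e2 := Real.one_le_exp (mul_nonneg hL0 hτ.le)
      have e3 : 0 ≤ K * τ := by positivity
      rw [add_mul, Real.exp_add, hη]
      nlinarith
    calc R ≤ (1 + η) ^ 2 := by rw [hR]; nlinarith
      _ ≤ Real.exp ((K + L) * τ) ^ 2 := by gcongr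
      _ = _ := by rw [← Real.exp_nat_mul]; congr 1; push_cast; ring
  calc _ ≤ ∑ z ∈ subIdx w M, ∫ x in lft w M z - m z..rgt w M z - m z, g (ρ z) (X x) :=
        Finset.sum_le_sum hlocal
    _ = ∑ i ∈ Finset.range M, ∑ z ∈ subIdx w M with ρ z = i,
        ∫ x in lft w M z - m z..rgt w M z - m z, g (ρ z) (X x) :=
        (Finset.sum_fiberwise_of_maps_to (fun z _ => Finset.mem_range.2 (hρM z)) _).symm
    _ ≤ ∑ i ∈ Finset.range M, Real.exp (L * τ) * (R ^ n * I i) := Finset.sum_le_sum hfiber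
    _ = Real.exp (L * τ) * R ^ n * ∫ x in (0 : ℝ)..1, e x ^ 2 := by
        rw [← Finset.mul_sum, ← Finset.mul_sum, hsum, mul_assoc]
    _ ≤ Real.exp (L * τ) * Real.exp (2 * (K + L) * τ) ^ n * ∫ x in (0 : ℝ)..1, e x ^ 2 := by
        have : 0 ≤ ∫ x in (0 : ℝ)..1, e x ^ 2 :=
          intervalIntegral.integral_nonneg zero_le_one fun x _ => sq_nonneg _
        gcongr
    _ = _ := by
        rw [← Real.exp_nat_mul, ← Real.exp_add]
        congr 2
        ring

/-! ### The error of one step -/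

lemma l2norm_nonneg (f : ℝ → ℝ) : 0 ≤ l2norm f := Real.sqrt_nonneg _

lemma l2norm_sq (f : ℝ → ℝ) : l2norm f ^ 2 = ∫ x in (0 : ℝ)..1, f x ^ 2 :=
  Real.sq_sqrt (intervalIntegral.integral_nonneg zero_le_one fun _ _ => sq_nonneg _)

lemma l2norm_sub_comm (f g : ℝ → ℝ) :
    l2norm (fun x => f x - g x) = l2norm fun x => g x - f x := by
  unfold l2norm
  congr 2
  ext x
  ring

lemma l2norm_le_add_const {f g : ℝ → ℝ} {c : ℝ} (hc : 0 ≤ c)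
    (hf : IntervalIntegrable (fun x => f x ^ 2) MeasureTheory.volume 0 1)
    (hg : IntervalIntegrable (fun x => g x ^ 2) MeasureTheory.volume 0 1)
    (h : ∀ x, |g x| ≤ |f x| + c) : l2norm g ≤ l2norm f + c := by
  refine le_of_forall_pos_le_add fun δ hδ => ?_
  have hN := l2norm_nonneg f
  set F := l2norm f + δ / 2 with hF
  set c' := c + δ / 2 with hc'
  have hF0 : 0 < F := by linarith
  have hc0 : 0 < c' := by linarith
  have hint : l2norm g ^ 2 ≤ (F + c') ^ 2 := by
    rw [l2norm_sq]
    calc ∫ x in (0 : ℝ)..1, g x ^ 2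
        ≤ ∫ x in (0 : ℝ)..1, ((1 + c' / F) * f x ^ 2 + (1 + F / c') * c' ^ 2) := by
          refine intervalIntegral.integral_mono_on zero_le_one hg
            ((hf.const_mul _).add intervalIntegrable_const) fun x _ => ?_
          have h1 : g x ^ 2 ≤ (|f x| + c') ^ 2 := by
            rw [← sq_abs (g x)]
            have := h x
            gcongr
            linarith
          have h2 : 2 * |f x| * c' ≤ c' / F * |f x| ^ 2 + F / c' * c' ^ 2 := by
            have : c' / F * |f x| ^ 2 + F / c' * c' ^ 2 - 2 * |f x| * c' =
                c' / F * (|f x| - F) ^ 2 := by field_simp; ring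
            have : 0 ≤ c' / F * (|f x| - F) ^ 2 := by positivity
            linarith
          rw [← sq_abs (f x)]
          nlinarith
      _ = (1 + c' / F) * l2norm f ^ 2 + (1 + F / c') * c' ^ 2 := by
          rw [intervalIntegral.integral_add (hf.const_mul _) intervalIntegrable_const,
            intervalIntegral.integral_const_mul, l2norm_sq]
          simp
      _ ≤ (1 + c' / F) * F ^ 2 + (1 + F / c') * c' ^ 2 := by
          gcongr
          linarith
      _ = (F + c') ^ 2 := by field_simp; ring
  have := (sq_le_sq₀ (l2norm_nonneg g) (by linarith)).1 hint
  linarith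

lemma IsDG.sub {k M : ℕ} {f g : ℝ → ℝ} (hf : IsDG k M f) (hg : IsDG k M g) :
    IsDG k M fun x => f x - g x := by
  refine ⟨hf.1.sub hg.1, fun i hi => ?_⟩
  obtain ⟨p, hp, hpx⟩ := hf.2 i hi
  obtain ⟨q, hq, hqx⟩ := hg.2 i hi
  exact ⟨p - q, (Polynomial.natDegree_sub_le _ _).trans (max_le hp hq),
    fun x hx => by simp only [hpx x hx, hqx x hx, Polynomial.eval_sub]⟩

lemma sum_sum_mul_le_sqrt {ι κ : Type*} [Fintype κ] (s : Finset ι) {W a c : ι → κ → ℝ}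
    (hW : ∀ i ∈ s, ∀ j, 0 ≤ W i j) :
    ∑ i ∈ s, ∑ j, W i j * a i j * c i j ≤
      √(∑ i ∈ s, ∑ j, W i j * a i j ^ 2) * √(∑ i ∈ s, ∑ j, W i j * c i j ^ 2) := by
  simp only [← Finset.sum_product']
  have hW' : ∀ z ∈ s ×ˢ (Finset.univ : Finset κ), 0 ≤ W z.1 z.2 := fun z hz =>
    hW _ (Finset.mem_product.1 hz).1 _
  have key := Real.sum_mul_le_sqrt_mul_sqrt (s ×ˢ (Finset.univ : Finset κ))
    (fun z => √(W z.1 z.2) * a z.1 z.2) (fun z => √(W z.1 z.2) * c z.1 z.2)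
  have e1 : ∀ z ∈ s ×ˢ (Finset.univ : Finset κ), √(W z.1 z.2) * a z.1 z.2 *
      (√(W z.1 z.2) * c z.1 z.2) = W z.1 z.2 * a z.1 z.2 * c z.1 z.2 := fun z hz => by
    rw [mul_mul_mul_comm, Real.mul_self_sqrt (hW' z hz), mul_assoc]
  have e2 : ∀ d : ι → κ → ℝ, ∀ z ∈ s ×ˢ (Finset.univ : Finset κ),
      (√(W z.1 z.2) * d z.1 z.2) ^ 2 = W z.1 z.2 * d z.1 z.2 ^ 2 := fun d z hz => by
    rw [mul_pow, Real.sq_sqrt (hW' z hz)]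
  rwa [Finset.sum_congr rfl e1, Finset.sum_congr rfl (e2 a), Finset.sum_congr rfl (e2 c)] at key

section step

variable {k : ℕ} {ξ ω : Fin (k + 1) → ℝ} {w : ℝ → ℝ} {M : ℕ}

lemma IsGaussRule.sum_eq_integral (hG : IsGaussRule k ξ ω) (hM : 1 ≤ M)
    (hfin : ∀ i < M, (crossings w M i).Finite) {f g : ℝ → ℝ} (hf : IsDG k M f)
    (hg : IsDG k M g) :
    ∑ z ∈ subIdx w M, ∑ α, ω α / 2 * (rgt w M z - lft w M z) *
      f (node w M z.1 z.2 (ξ α)) * g (node w M z.1 z.2 (ξ α)) =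
      ∫ x in (0 : ℝ)..1, f x * g x := by
  rw [← sum_integral_subIdx hM hfin
    ((hf.isCellwiseContinuous.mul hg.isCellwiseContinuous).intervalIntegrable hM)]
  refine Finset.sum_congr rfl fun z hz => ?_
  obtain ⟨p, hp, hpx⟩ := hf.2 z.1 (mem_subIdx.1 hz).1
  obtain ⟨q, hq, hqx⟩ := hg.2 z.1 (mem_subIdx.1 hz).1
  have hsub := Ioo_subset_cell hM hfin hz
  have hpq : (p * q).natDegree ≤ 2 * k + 1 := Polynomial.natDegree_mul_le.trans (by omega)
  calc _ = ∑ α, ω α / 2 * (rgt w M z - lft w M z) *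
        (p * q).eval (lft w M z + (1 + ξ α) / 2 * (rgt w M z - lft w M z)) := by
        refine Finset.sum_congr rfl fun α _ => ?_
        have hn := hsub (node_mem hM hfin hz (hG.mem α))
        rw [hpx _ hn, hqx _ hn, Polynomial.eval_mul, mul_assoc]
        rfl
    _ = ∫ x in lft w M z..rgt w M z, (p * q).eval x := hG.integral_eq hpq _ _
    _ = _ := intervalIntegral.integral_congr_Ioo_of_le (lft_lt_rgt hM hfin hz).le fun x hx => by
        simp only [hpx x (hsub hx), hqx x (hsub hx), Polynomial.eval_mul]

lemma isDG_one : IsDG k M fun _ => 1 :=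
  ⟨fun _ => rfl, fun _ _ => ⟨1, by simp, by simp⟩⟩

lemma IsGaussRule.step_error_le (hG : IsGaussRule k ξ ω) (hM : 1 ≤ M)
    (hfin : ∀ i < M, (crossings w M i).Finite) {u u' π π' v v' : ℝ → ℝ}
    (hstep : IsSchemeStep ξ ω M w u u') (hπ' : IsDG k M π')
    {G c d : ℝ} (hG0 : 0 ≤ G)
    (hS : ∑ z ∈ subIdx w M, ∑ α, ω α / 2 * (rgt w M z - lft w M z) *
        (u (w (node w M z.1 z.2 (ξ α))) - π (w (node w M z.1 z.2 (ξ α)))) ^ 2 ≤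
      G ^ 2 * ∫ x in (0 : ℝ)..1, (u x - π x) ^ 2)
    (hv : ∀ x, |π x - v x| ≤ c) (hv' : ∀ x, |π' x - v' x| ≤ c)
    (hd : ∀ x ∈ Set.Icc (0 : ℝ) 1, |v (w x) - v' x| ≤ d) :
    l2norm (fun x => u' x - π' x) ≤ G * l2norm (fun x => u x - π x) + (2 * c + d) := by
  obtain ⟨hu', hform⟩ := hstep
  set φ : ℝ → ℝ := fun x => u' x - π' x with hφ
  have hφDG : IsDG k M φ := hu'.sub hπ'
  set W : (Σ _ : ℕ, ℕ) → Fin (k + 1) → ℝ := fun z α => ω α / 2 * (rgt w M z - lft w M z) with hWd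
  set X : (Σ _ : ℕ, ℕ) → Fin (k + 1) → ℝ := fun z α => node w M z.1 z.2 (ξ α) with hX
  have hW : ∀ z ∈ subIdx w M, ∀ α, 0 ≤ W z α := fun z hz α => by
    have h1 := lft_lt_rgt hM hfin hz
    have h2 := hG.weight_pos α
    exact mul_nonneg (by linarith) (by linarith)
  have hcd : 0 ≤ 2 * c + d := by
    have h1 := (abs_nonneg _).trans (hv 0)
    have h2 := (abs_nonneg _).trans (hd 0 ⟨le_rfl, zero_le_one⟩)
    linarith
  have hφsq : √(∑ z ∈ subIdx w M, ∑ α, W z α * φ (X z α) ^ 2) = l2norm φ := by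
    have := hG.sum_eq_integral hM hfin hφDG hφDG
    simp only [mul_assoc, ← pow_two] at this
    simp only [hWd, hX, mul_assoc, this, l2norm]
  have hone : ∑ z ∈ subIdx w M, ∑ α, W z α = 1 := by
    have := hG.sum_eq_integral hM hfin (isDG_one (k := k)) (isDG_one (k := k))
    simpa using this
  set r : (Σ _ : ℕ, ℕ) → Fin (k + 1) → ℝ := fun z α => π (w (X z α)) - π' (X z α) with hr
  have hrle : ∀ z ∈ subIdx w M, ∀ α, |r z α| ≤ 2 * c + d := fun z hz α => by
    have hmem := Icc_subset_unit hM hfin hz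
      (Set.Ioo_subset_Icc_self (node_mem hM hfin hz (hG.mem α)))
    have h1 := abs_le.1 (hv (w (X z α)))
    have h2 := abs_le.1 (hv' (X z α))
    have h3 := abs_le.1 (hd _ hmem)
    exact abs_le.2 ⟨by simp only [hr]; linarith, by simp only [hr]; linarith⟩
  have hrsq : √(∑ z ∈ subIdx w M, ∑ α, W z α * r z α ^ 2) ≤ 2 * c + d := by
    refine Real.sqrt_le_iff.2 ⟨hcd, ?_⟩
    calc _ ≤ ∑ z ∈ subIdx w M, ∑ α, W z α * (2 * c + d) ^ 2 := by
          refine Finset.sum_le_sum fun z hz => Finset.sum_le_sum fun α _ => ?_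
          refine mul_le_mul_of_nonneg_left ?_ (hW z hz α)
          exact sq_le_sq' (neg_le_of_abs_le (hrle z hz α)) (le_of_abs_le (hrle z hz α))
      _ = (2 * c + d) ^ 2 := by
          simp only [← Finset.sum_mul]
          rw [hone, one_mul]
  have hSsq : √(∑ z ∈ subIdx w M, ∑ α, W z α * (u (w (X z α)) - π (w (X z α))) ^ 2) ≤
      G * l2norm fun x => u x - π x := by
    refine Real.sqrt_le_iff.2 ⟨mul_nonneg hG0 (l2norm_nonneg _), ?_⟩
    rw [mul_pow, l2norm_sq]
    exact hS
  have hmain : l2norm φ ^ 2 =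
      ∑ z ∈ subIdx w M, ∑ α, W z α * (u (w (X z α)) - π (w (X z α))) * φ (X z α) +
      ∑ z ∈ subIdx w M, ∑ α, W z α * r z α * φ (X z α) := by
    have h1 := hform φ hφDG
    rw [gaussForm_eq_sum] at h1
    have h2 := hG.sum_eq_integral hM hfin hπ' hφDG
    have h3 : ∫ x in (0 : ℝ)..1, φ x ^ 2 =
        (∫ x in (0 : ℝ)..1, u' x * φ x) - ∫ x in (0 : ℝ)..1, π' x * φ x := by
      rw [← intervalIntegral.integral_sub
        ((hu'.isCellwiseContinuous.mul hφDG.isCellwiseContinuous).intervalIntegrable hM)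
        ((hπ'.isCellwiseContinuous.mul hφDG.isCellwiseContinuous).intervalIntegrable hM)]
      refine intervalIntegral.integral_congr fun x _ => ?_
      simp only [hφ]
      ring
    rw [l2norm_sq, h3, h1, ← h2, ← Finset.sum_sub_distrib, ← Finset.sum_add_distrib]
    refine Finset.sum_congr rfl fun z _ => ?_
    rw [← Finset.sum_sub_distrib, ← Finset.sum_add_distrib]
    refine Finset.sum_congr rfl fun α _ => ?_
    simp only [hWd, hr, hX]
    ring
  have hle : l2norm φ ^ 2 ≤
      (G * l2norm (fun x => u x - π x) + (2 * c + d)) * l2norm φ := by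
    rw [hmain, add_mul]
    have hφ0 := l2norm_nonneg φ
    refine add_le_add ((sum_sum_mul_le_sqrt _ hW).trans ?_) ((sum_sum_mul_le_sqrt _ hW).trans ?_)
    · rw [hφsq]; gcongr
    · rw [hφsq]; gcongr
  rcases (l2norm_nonneg φ).eq_or_lt with h0 | h0
  · rw [← h0]
    exact add_nonneg (mul_nonneg hG0 (l2norm_nonneg _)) hcd
  · exact le_of_mul_le_mul_right (by rwa [pow_two] at hle) h0

end step

lemma exists_isDG_approx {k M : ℕ} (hM : 1 ≤ M) {f : ℝ → ℝ} (hf : Function.Periodic f 1) {c : ℝ}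
    (h : ∀ a : ℝ, ∃ p : Polynomial ℝ, p.natDegree ≤ k ∧
      ∀ x ∈ Set.Icc a (a + 1 / M), |f x - p.eval x| ≤ c) :
    ∃ π, IsDG k M π ∧ ∀ x, |π x - f x| ≤ c := by
  have hM' : (0 : ℝ) < M := by exact_mod_cast hM
  choose p hpd hp using h
  refine ⟨fun x => (p ((⌊M * Int.fract x⌋₊ : ℝ) / M)).eval (Int.fract x),
    ⟨fun x => by simp only [Int.fract_add_one], fun i hi => ⟨p ((i : ℝ) / M), hpd _, ?_⟩⟩, ?_⟩
  · intro x hx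
    have h0 : 0 < x := lt_of_le_of_lt (by positivity) hx.1
    have h1 : x < 1 := hx.2.trans_le (by rw [div_le_one hM']; exact_mod_cast hi)
    have hfr : Int.fract x = x := Int.fract_eq_self.2 ⟨h0.le, h1⟩
    have hfl : ⌊M * x⌋₊ = i := by
      rw [Nat.floor_eq_iff (by positivity)]
      have a1 := (div_lt_iff₀ hM').1 hx.1
      have a2 := (lt_div_iff₀ hM').1 hx.2
      exact ⟨by linarith, by linarith⟩
    simp only [hfr, hfl]
  · intro x
    have hper : f x = f (Int.fract x) := by
      have := hf.sub_int_mul_eq (x := x) ⌊x⌋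
      rw [mul_one] at this
      exact this.symm
    rw [hper, abs_sub_comm]
    have h0 := Int.fract_nonneg x
    refine hp _ _ ⟨?_, ?_⟩
    · rw [div_le_iff₀ hM', mul_comm]
      exact Nat.floor_le (by positivity)
    · rw [← add_div, le_div_iff₀ hM', mul_comm]
      exact (Nat.lt_floor_add_one _).le

/-! ### The exact solution -/

lemma IsAdvectionSolution.eq_comp_flow {b v₀ : ℝ → ℝ} {T : ℝ} {v : ℝ → ℝ → ℝ}
    (hv : IsAdvectionSolution b v₀ T v) {y : ℝ → ℝ → ℝ} (hy : IsCharacteristicFlow b y)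
    {t : ℝ} (ht : t ∈ Set.Icc 0 T) (x : ℝ) : v t x = v₀ (y x (-t)) := by
  have hY : ∀ s, HasDerivAt (fun s => y x (s - t)) (b (y x (s - t))) s := fun s => by
    simpa using ((hy x).2 (s - t)).comp_sub_const s t
  have hYc : Continuous fun s => y x (s - t) :=
    continuous_iff_continuousAt.2 fun s => (hY s).continuousAt
  rcases ht.1.eq_or_lt with rfl | ht0
  · rw [hv.initial, neg_zero, (hy x).1]
  have hd : ∀ s ∈ Set.Ioo 0 t, HasDerivAt (fun s => v s (y x (s - t))) 0 s := by
    intro s hs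
    have hsT : s ∈ Set.Ioo 0 T := ⟨hs.1, hs.2.trans_le ht.2⟩
    set z := y x (s - t)
    have hF := (hv.differentiableAt s hsT z).hasFDerivAt
    set D := fderiv ℝ (fun z : ℝ × ℝ => v z.1 z.2) (s, z)
    have h1 : HasDerivAt (fun r => v r z) (D (1, 0)) s :=
      HasFDerivAt.comp_hasDerivAt (f := fun r => (r, z)) s hF
        ((hasDerivAt_id s).prodMk (hasDerivAt_const s z))
    have h2 : HasDerivAt (v s) (D (0, 1)) z :=
      HasFDerivAt.comp_hasDerivAt (f := fun r => (s, r)) z hF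
        ((hasDerivAt_const z s).prodMk (hasDerivAt_id z))
    have h3 : HasDerivAt (fun r => v r (y x (r - t))) (D (1, b z)) s :=
      HasFDerivAt.comp_hasDerivAt (f := fun r => (r, y x (r - t))) s hF
        ((hasDerivAt_id s).prodMk (hY s))
    have hpde := hv.pde s hsT z
    rw [h1.deriv, h2.deriv] at hpde
    have : D (1, b z) = D (1, 0) + b z * D (0, 1) := by
      rw [← smul_eq_mul, ← map_smul, ← map_add]
      simp
    rw [this, hpde] at h3
    exact h3
  have hc : ContinuousOn (fun s => v s (y x (s - t))) (Set.Icc 0 t) :=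
    hv.continuousOn.comp (f := fun s => (s, y x (s - t)))
      (continuous_id.prodMk hYc).continuousOn fun s hs => ⟨⟨hs.1, hs.2.trans ht.2⟩, trivial⟩
  obtain ⟨s, hs, he⟩ := exists_hasDerivAt_eq_slope _ _ ht0 hc hd
  rw [eq_comm, div_eq_zero_iff] at he
  have he' := he.resolve_right (by linarith)
  simp only [sub_self, (hy x).1, zero_sub, hv.initial] at he'
  linarith

lemma discrete_gronwall {a : ℕ → ℝ} {G q : ℝ} {N : ℕ} (hG : 1 ≤ G) (hq : 0 ≤ q)
    (h : ∀ n < N, a (n + 1) ≤ G * a n + q) : ∀ n ≤ N, a n ≤ G ^ n * (a 0 + n * q) := by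
  intro n hn
  induction n with
  | zero => simp
  | succ n ih =>
    have h1 : q ≤ G ^ (n + 1) * q := le_mul_of_one_le_left hq (one_le_pow₀ hG)
    calc a (n + 1) ≤ G * a n + q := h n hn
      _ ≤ G * (G ^ n * (a 0 + n * q)) + q := by
        have := ih (by omega)
        gcongr
      _ = G ^ (n + 1) * (a 0 + n * q) + q := by ring
      _ ≤ G ^ (n + 1) * (a 0 + n * q) + G ^ (n + 1) * q := by gcongr
      _ = _ := by push_cast; ring

end

end SLDG

theorem mainTheorem9
    (k : ℕ) (ξ ω : Fin (k + 1) → ℝ) (hGauss : SLDG.IsGaussRule k ξ ω)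
    (b : ℝ → ℝ) (hb : ContDiff ℝ ((2 * k + 2 : ℕ) : WithTop ℕ∞) b)
    (hbper : Function.Periodic b 1)
    (y : ℝ → ℝ → ℝ) (hy : SLDG.IsCharacteristicFlow b y)
    (v₀ : ℝ → ℝ) (hv₀ : ContDiff ℝ ((k + 1 : ℕ) : WithTop ℕ∞) v₀)
    (hv₀per : Function.Periodic v₀ 1) (K : ℝ) :
    ∃ C₁ C : ℝ, 0 ≤ C₁ ∧ 0 ≤ C ∧
      ∀ (T : ℝ) (N M : ℕ), 0 < T → 1 ≤ N → 1 ≤ M →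
      ∀ Δt Δx : ℝ, Δt = T / N → Δx = 1 / M →
      ∀ v : ℝ → ℝ → ℝ, SLDG.IsAdvectionSolution b v₀ T v →
      ∀ (ε : ℝ) (ybar : ℝ → ℝ),
        (∀ x ∈ Set.Icc (0 : ℝ) 1, |ybar x - y x (-Δt)| ≤ ε) →
        ε ≤ K * (Δx * Δt) →
        ContinuousOn ybar (Set.Icc 0 1) →
        (∀ i < M, (SLDG.crossings ybar M i).Finite) →
      ∀ u : ℕ → ℝ → ℝ, SLDG.IsDG k M (u 0) →
        (∀ n < N, SLDG.IsSchemeStep ξ ω M ybar (u n) (u (n + 1))) →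
      ∀ n ≤ N,
        SLDG.l2norm (fun x => u n x - v (n * Δt) x) ≤
          Real.exp (C₁ * T) *
            (SLDG.l2norm (fun x => v 0 x - u 0 x) + C * T * (Δx ^ (k + 1) / Δt)
              + C * T * (ε / (Δx * Δt))) := by
  have hb1 : ContDiff ℝ 1 b := hb.of_le (by exact_mod_cast (by omega : 1 ≤ 2 * k + 2))
  have hbk : ContDiff ℝ (k + 1 : ℕ) b :=
    hb.of_le (by exact_mod_cast (by omega : k + 1 ≤ 2 * k + 2))
  have hv1 : ContDiff ℝ 1 v₀ := hv₀.of_le (by exact_mod_cast (by omega : 1 ≤ k + 1))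
  obtain ⟨L, hL0, hL⟩ := hbper.deriv_periodic.exists_abs_le (hb1.continuous_deriv le_rfl)
  obtain ⟨Λ, hΛ0, hΛ⟩ := hv₀per.deriv_periodic.exists_abs_le (hv1.continuous_deriv le_rfl)
  obtain ⟨B, hB0, happrox⟩ :=
    (hy.smoothGrowth_comp_flow hbk hbper hv₀ hv₀per).exists_polynomial
  obtain ⟨c, hc0, hstab⟩ := SLDG.exists_stability hGauss hb1 hbper hy hL (abs_nonneg K)
  refine ⟨c / 2 + (B + L), 4 * B + Λ, by positivity, by positivity, ?_⟩
  intro T N M hT hN hM Δt Δx hΔt hΔx v hv ε w hw hε hwc hfin u hu0 hstep n hn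
  have hN' : (0 : ℝ) < N := by exact_mod_cast hN
  have hM' : (0 : ℝ) < M := by exact_mod_cast hM
  have hτ : 0 < Δt := by rw [hΔt]; positivity
  have hh : 0 < Δx := by rw [hΔx]; positivity
  have hNT : (N : ℝ) * Δt = T := by rw [hΔt]; field_simp
  have hε0 : 0 ≤ ε := (abs_nonneg _).trans (hw 0 ⟨le_rfl, zero_le_one⟩)
  set t : ℕ → ℝ := fun n => n * Δt with ht
  have htmem : ∀ n ≤ N, t n ∈ Set.Icc 0 T := fun n hn => by
    refine ⟨by positivity, ?_⟩
    rw [← hNT]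
    have : (n : ℝ) ≤ N := by exact_mod_cast hn
    exact mul_le_mul_of_nonneg_right this hτ.le
  have hveq : ∀ n ≤ N, ∀ x, v (t n) x = v₀ (y x (-t n)) := fun n hn x =>
    hv.eq_comp_flow hy (htmem n hn) x
  have hvcont : ∀ n ≤ N, Continuous (v (t n)) := fun n hn => by
    have e : v (t n) = fun x => v₀ (y x (-t n)) := funext (hveq n hn)
    rw [e]
    exact hv₀.continuous.comp
      ((hy.continuous_uncurry hb1 hL).comp (continuous_const.prodMk continuous_id))
  set E := Real.exp ((B + L) * T) with hE
  have hE0 : 0 < E := Real.exp_pos _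
  set a := B * E * Δx ^ (k + 1) with ha
  have ha0 : 0 ≤ a := by positivity
  have hπ : ∀ n, ∃ π, n ≤ N → SLDG.IsDG k M π ∧ ∀ x, |π x - v (t n) x| ≤ a := by
    intro n
    by_cases hn : n ≤ N
    · obtain ⟨π, hπ, hπv⟩ := SLDG.exists_isDG_approx hM (k := k) (c := a)
        (hv.periodic _ (htmem n hn)) fun z => by
          obtain ⟨p, hp, hpx⟩ := happrox (-t n) z (1 / M) (by positivity)
          refine ⟨p, hp, fun x hx => ?_⟩
          rw [hveq n hn]
          refine (hpx x hx).trans ?_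
          rw [ha, hE, ← hΔx, abs_neg, abs_of_nonneg (htmem n hn).1]
          have := (htmem n hn).2
          have := (htmem n hn).1
          gcongr
          linarith
      exact ⟨π, fun _ => ⟨hπ, hπv⟩⟩
    · exact ⟨0, fun h => absurd h hn⟩
  choose π hπ using hπ
  have huDG : ∀ n ≤ N, SLDG.IsDG k M (u n) := fun n hn => by
    cases n with
    | zero => exact hu0
    | succ n => exact (hstep n (by omega)).1
  set d := Λ * E * ε with hd
  have hd0 : 0 ≤ d := by positivity
  have hLip : ∀ n < N, ∀ x ∈ Set.Icc (0 : ℝ) 1, |v (t n) (w x) - v (t (n + 1)) x| ≤ d := by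
    intro n hn x hx
    have hflow : y x (-t (n + 1)) = y (y x (-Δt)) (-t n) := by
      rw [hy.flow_add hb1]
      congr 1
      simp only [ht]
      push_cast
      ring
    have hlipv : ∀ p q, |v₀ p - v₀ q| ≤ Λ * |p - q| := fun p q =>
      Convex.norm_image_sub_le_of_norm_deriv_le
        (fun z _ => hv1.differentiable one_ne_zero z) (fun z _ => hΛ z) convex_univ
        (Set.mem_univ _) (Set.mem_univ _)
    rw [hveq n hn.le, hveq (n + 1) hn, hflow]
    have htn := htmem n hn.le
    have h1 := hy.abs_sub_le hb1 hL (y x (-Δt)) (w x) (-t n)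
    rw [abs_neg, abs_of_nonneg htn.1] at h1
    calc _ ≤ Λ * |y (w x) (-t n) - y (y x (-Δt)) (-t n)| := hlipv _ _
      _ ≤ Λ * (ε * E) := by
        have h2 : Real.exp (L * t n) ≤ E := by
          rw [hE]
          have h3 := htn.1
          have h4 := htn.2
          gcongr
          linarith
        refine mul_le_mul_of_nonneg_left (h1.trans ?_) hΛ0
        exact mul_le_mul (hw x hx) h2 (Real.exp_pos _).le hε0
      _ = d := by rw [hd]; ring
  have hεK : ε ≤ |K| * (1 / M * Δt) := by
    rw [← hΔx]
    exact hε.trans (mul_le_mul_of_nonneg_right (le_abs_self K) (by positivity))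
  have hone : ∀ n < N, SLDG.l2norm (fun x => u (n + 1) x - π (n + 1) x) ≤
      Real.exp (c / 2 * Δt) * SLDG.l2norm (fun x => u n x - π n x) + (2 * a + d) := by
    intro n hn
    refine hGauss.step_error_le hM hfin (hstep n hn) (hπ (n + 1) hn).1 (Real.exp_pos _).le ?_
      (hπ n hn.le).2 (hπ (n + 1) hn).2 (hLip n hn)
    have := hstab M Δt ε w _ hM hτ hwc hfin hw hεK ((huDG n hn.le).sub (hπ n hn.le).1)
    refine this.trans_eq ?_
    rw [← Real.exp_nat_mul]
    congr 2
    push_cast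
    ring
  have hiter := SLDG.discrete_gronwall (a := fun n => SLDG.l2norm fun x => u n x - π n x)
    (Real.one_le_exp (by positivity)) (by positivity) hone n hn
  have hpow : Real.exp (c / 2 * Δt) ^ n ≤ Real.exp (c / 2 * T) := by
    rw [← Real.exp_nat_mul]
    have h1 : (n : ℝ) * Δt ≤ T := (htmem n hn).2
    refine Real.exp_le_exp.2 ?_
    calc (n : ℝ) * (c / 2 * Δt) = c / 2 * (n * Δt) := by ring
      _ ≤ _ := by gcongr
  have cellwise : ∀ n ≤ N, SLDG.IsCellwiseContinuous M (v (t n)) := fun n hn =>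
    SLDG.isCellwiseContinuous_of_continuous (hvcont n hn)
  have hfinal : SLDG.l2norm (fun x => u n x - v (t n) x) ≤
      SLDG.l2norm (fun x => u n x - π n x) + a := by
    refine SLDG.l2norm_le_add_const ha0
      (((huDG n hn).sub (hπ n hn).1).isCellwiseContinuous.sq.intervalIntegrable hM)
      (((huDG n hn).isCellwiseContinuous.sub (cellwise n hn)).sq.intervalIntegrable hM)
      fun x => ?_
    calc |u n x - v (t n) x| = |(u n x - π n x) + (π n x - v (t n) x)| := by congr 1; ring
      _ ≤ _ := (abs_add_le _ _).trans (add_le_add le_rfl ((hπ n hn).2 x))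
  have ht0 : t 0 = 0 := by simp [ht]
  have hinit : SLDG.l2norm (fun x => u 0 x - π 0 x) ≤
      SLDG.l2norm (fun x => v 0 x - u 0 x) + a := by
    have h0 := Nat.zero_le N
    have hvc := cellwise 0 h0
    have hπv := (hπ 0 h0).2
    rw [ht0] at hvc hπv
    rw [SLDG.l2norm_sub_comm (v 0)]
    refine SLDG.l2norm_le_add_const ha0
      ((hu0.isCellwiseContinuous.sub hvc).sq.intervalIntegrable hM)
      ((hu0.sub (hπ 0 h0).1).isCellwiseContinuous.sq.intervalIntegrable hM) fun x => ?_
    calc |u 0 x - π 0 x| = |(u 0 x - v 0 x) - (π 0 x - v 0 x)| := by congr 1; ring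
      _ ≤ _ := (abs_sub _ _).trans (add_le_add le_rfl (hπv x))
  have hD0 := SLDG.l2norm_nonneg fun x => v 0 x - u 0 x
  set D := SLDG.l2norm fun x => v 0 x - u 0 x with hD
  have hF1 : 1 ≤ Real.exp (c / 2 * T) := Real.one_le_exp (by positivity)
  have hE1 : 1 ≤ E := Real.one_le_exp (by positivity)
  have hC1 : Real.exp ((c / 2 + (B + L)) * T) = Real.exp (c / 2 * T) * E := by
    rw [add_mul, Real.exp_add]
  set F := Real.exp (c / 2 * T) with hF
  rw [hC1]
  rcases Nat.eq_zero_or_pos n with rfl | hn0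
  · have h1 : (fun x => u 0 x - v (((0 : ℕ) : ℝ) * Δt) x) = fun x => u 0 x - v 0 x := by simp
    rw [h1, SLDG.l2norm_sub_comm, ← hD]
    have h2 : 0 ≤ (4 * B + Λ) * T * (Δx ^ (k + 1) / Δt) := by positivity
    have h3 : 0 ≤ (4 * B + Λ) * T * (ε / (Δx * Δt)) := by positivity
    refine le_trans ?_
      (le_mul_of_one_le_left (by positivity) (one_le_mul_of_one_le_of_one_le hF1 hE1))
    linarith
  · have hn1 : (1 : ℝ) ≤ n := by exact_mod_cast hn0
    have hnN : (n : ℝ) ≤ T / Δt := by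
      rw [le_div_iff₀ hτ]; exact (htmem n hn).2
    have hΔx1 : Δx ≤ 1 := by
      rw [hΔx, div_le_one hM']
      exact_mod_cast hM
    have hεx : ε ≤ ε / Δx := by
      rw [le_div_iff₀ hh]
      exact mul_le_of_le_one_right hε0 hΔx1
    calc SLDG.l2norm (fun x => u n x - v (t n) x)
        ≤ Real.exp (c / 2 * Δt) ^ n *
          (SLDG.l2norm (fun x => u 0 x - π 0 x) + n * (2 * a + d)) + a :=
          hfinal.trans (add_le_add hiter le_rfl)
      _ ≤ F * ((D + a) + n * (2 * a + d)) + F * a := by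
          have h1 : a ≤ F * a := le_mul_of_one_le_left ha0 hF1
          have h2 := SLDG.l2norm_nonneg fun x => u 0 x - π 0 x
          gcongr
      _ = F * (D + 2 * a + n * (2 * a + d)) := by ring
      _ ≤ F * (D + n * (2 * a) + n * (2 * a + d)) := by
          have h1 : 2 * a ≤ n * (2 * a) := le_mul_of_one_le_left (by positivity) hn1
          gcongr
      _ = F * (D + n * (4 * a + d)) := by ring
      _ ≤ F * (E * D + T / Δt * (4 * (B * E * Δx ^ (k + 1)) + Λ * E * (ε / Δx))) := by
          have h1 : D ≤ E * D := le_mul_of_one_le_left hD0 hE1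
          have h2 : d ≤ Λ * E * (ε / Δx) := by rw [hd]; gcongr
          gcongr
      _ = F * E * (D + 4 * B * T * (Δx ^ (k + 1) / Δt) + Λ * T * (ε / (Δx * Δt))) := by
          field_simp
          ring
      _ ≤ F * E * (D + (4 * B + Λ) * T * (Δx ^ (k + 1) / Δt) +
          (4 * B + Λ) * T * (ε / (Δx * Δt))) := by
          gcongr <;> linarith
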